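/- Let $\Omega\subset\mathbb C$ be a domain (a nonempty connected open set) and let $\delta_\Omega(z)\in(0,\infty]$ denote the distance from $z\in\Omega$ to $\partial\Omega$. Define the Hardy constant $h(\Omega)\in[0,\infty]$ by $$h(\Omega)^2:=\inf\left\{\frac{\int_\Omega|\nabla\phi|^2}{\int_\Omega\phi^2/\delta_\Omega^2}:\ \phi\in C_0^\infty(\Omega)\setminus\{0\}\text{ real-valued}\right\}.$$ Let $K_\Omega(z,w)$ be the Bergman kernel of $\Omega$, i.e. for each $w\in\Omega$, $K_\Omega(\cdot,w)$ is the unique element of the space $A^2(\Omega)$ of square-integrable holomorphic functions on $\Omega$ such that $f(w)=\int_\Omega f\,\overline{K_\Omega(\cdot,w)}$ for all $f\in A^2(\Omega)$. Define the integrability index $$\beta(\Omega):=\sup\{\beta\ge 2:\ K_\Omega(\cdot,w)\in L^\beta(\Omega)\ \ \forall\, w\in\Omega\}\in[2,\infty].$$ Then $$\beta(\Omega)\ \ge\ \frac{6}{3-h(\Omega)}.$$ (If $\Omega\ne\mathbb C$, then $h(\Omega)\le 1$ and the right-hand side is a finite positive number. If $\Omega=\mathbb C$, then $\delta_\Omega\equiv\infty$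 and $h(\Omega)=\infty$, and the right-hand side is read as $+\infty$.) -/

import Mathlib

open MeasureTheory Metric
open scoped ENNReal NNReal ContDiff ComplexConjugate

noncomputable section

/-- The boundary distance `δ_Ω`, with values in `[0, ∞]`
(it is identically `∞` when the boundary is empty, that is, for `Ω = ℂ`). -/
def boundaryDist (Ω : Set ℂ) (z : ℂ) : ℝ≥0∞ :=
  infEDist z (frontier Ω)

/-- Real-valued smooth functions with compact support contained in `Ω`. -/
def IsTestFunction (Ω : Set ℂ) (φ : ℂ → ℝ) : Prop :=
  ContDiff ℝ ∞ φ ∧ HasCompactSupport φ ∧ tsupport φ ⊆ Ω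

/-- The Hardy quotient `∫_Ω |∇φ|² / ∫_Ω φ² / δ_Ω²`. The operator norm of the real derivative of
`φ` is the Euclidean length of its gradient. -/
def hardyQuotient (Ω : Set ℂ) (φ : ℂ → ℝ) : ℝ≥0∞ :=
  (∫⁻ z in Ω, ‖fderiv ℝ φ z‖ₑ ^ 2) / ∫⁻ z in Ω, ‖φ z‖ₑ ^ 2 / boundaryDist Ω z ^ 2

/-- The Hardy constant `h(Ω)`: its square is the infimum of the Hardy quotient over all nonzero
test functions. -/
def hardyConstant (Ω : Set ℂ) : ℝ≥0∞ :=
  (⨅ (φ : ℂ → ℝ) (_ : IsTestFunction Ω φ ∧ φ ≠ 0), hardyQuotient Ω φ) ^ (1 / 2 : ℝ)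

/-- Membership in the Bergman space `A²(Ω)` of square integrable holomorphic functions on `Ω`. -/
def MemBergman (Ω : Set ℂ) (f : ℂ → ℂ) : Prop :=
  DifferentiableOn ℂ f Ω ∧ MemLp f 2 (volume.restrict Ω)

/-- `k` represents evaluation at `w` on the Bergman space `A²(Ω)`. -/
def IsReproducingAt (Ω : Set ℂ) (w : ℂ) (k : ℂ → ℂ) : Prop :=
  MemBergman Ω k ∧ ∀ f : ℂ → ℂ, MemBergman Ω f → f w = ∫ z in Ω, f z * conj (k z)

open Classical in
/-- The Bergman kernel `K_Ω(z, w)`: for `w ∈ Ω`, the function `K_Ω(·, w)` is the element of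
`A²(Ω)` that represents evaluation at `w`. It exists and is unique on an open set, see
`bergmanKernel_spec` and `IsReproducingAt.eqOn` below. -/
def bergmanKernel (Ω : Set ℂ) (z w : ℂ) : ℂ :=
  if h : ∃ k, IsReproducingAt Ω w k then h.choose z else 0

/-- The integrability index of the Bergman kernel: the supremum, in `[0, ∞]`, of all real
`p ≥ 2` such that `K_Ω(·, w) ∈ L^p(Ω)` for every `w ∈ Ω`. -/
def integrabilityIndex (Ω : Set ℂ) : ℝ≥0∞ :=
  ⨆ (p : ℝ≥0) (_ : 2 ≤ p ∧ ∀ w ∈ Ω,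
    MemLp (fun z => bergmanKernel Ω z w) (p : ℝ≥0∞) (volume.restrict Ω)), (p : ℝ≥0∞)

/-! Existence and uniqueness of the Bergman kernel. -/

/-- Circular mean value inequality. -/
theorem enorm_le_lintegral_circle {f : ℂ → ℂ} {w : ℂ} {r s : ℝ} (hs : 0 < s) (hsr : s < r)
    (hf : DifferentiableOn ℂ f (ball w r)) :
    ENNReal.ofReal (2 * Real.pi) * ‖f w‖ₑ ≤
      ∫⁻ θ in Set.Ioo (-Real.pi) Real.pi, ‖f (w + Complex.polarCoord.symm (s, θ))‖ₑ := by
  have hd : DiffContOnCl ℂ f (ball w |s|) := by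
    rw [abs_of_pos hs]
    exact (hf.mono (closure_ball_subset_closedBall.trans
      (closedBall_subset_ball hsr))).diffContOnCl
  have h1 := hd.circleAverage
  rw [Real.circleAverage_def] at h1
  have hpi := Real.pi_pos
  have h2 : (2 * Real.pi : ℝ) • f w = ∫ θ in (0 : ℝ)..2 * Real.pi, f (circleMap w s θ) := by
    rw [← h1, smul_smul, mul_inv_cancel₀ (by positivity), one_smul]
  have hper : Function.Periodic (fun θ => f (circleMap w s θ)) (2 * Real.pi) := fun θ => by
    simp only [periodic_circleMap w s θ]
  have h3 := hper.intervalIntegral_add_eq 0 (-Real.pi)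
  rw [zero_add, show -Real.pi + 2 * Real.pi = Real.pi by ring] at h3
  rw [h3, intervalIntegral.integral_of_le (by linarith)] at h2
  have h4 : ‖(2 * Real.pi : ℝ) • f w‖ₑ = ENNReal.ofReal (2 * Real.pi) * ‖f w‖ₑ := by
    rw [enorm_smul, Real.enorm_of_nonneg (by positivity)]
  rw [← h4, h2, integral_Ioc_eq_integral_Ioo]
  refine (enorm_integral_le_lintegral_enorm _).trans (le_of_eq ?_)
  refine lintegral_congr fun θ => ?_
  simp [circleMap, Complex.exp_mul_I]

/-- The weight of a disc of radius `r`, written as an integral in the radius. -/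
def discMass (r : ℝ) : ℝ≥0∞ :=
  ∫⁻ s in Set.Ioo 0 r, ENNReal.ofReal s * ENNReal.ofReal (2 * Real.pi)

theorem discMass_ne_zero {r : ℝ} (hr : 0 < r) : discMass r ≠ 0 := by
  have hpi := Real.pi_pos
  unfold discMass
  rw [← pos_iff_ne_zero, setLIntegral_pos_iff (by fun_prop)]
  have : (Function.support fun s : ℝ => ENNReal.ofReal s * ENNReal.ofReal (2 * Real.pi)) ∩
      Set.Ioo 0 r = Set.Ioo 0 r := by
    refine Set.inter_eq_right.2 fun s hs => ?_
    have := hs.1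
    simp [Function.mem_support, hs.1, hpi]
  rw [this]
  simp [hr]

/-- Mean value inequality on discs. -/
theorem enorm_mul_discMass_le {f : ℂ → ℂ} {w : ℂ} {r : ℝ}
    (hf : DifferentiableOn ℂ f (ball w r)) :
    ‖f w‖ₑ * discMass r ≤ ∫⁻ z in ball w r, ‖f z‖ₑ := by
  set F : ℂ → ℝ≥0∞ := (ball w r).indicator fun z => ‖f z‖ₑ with hF
  have hFm : Measurable F := by
    have hc : ContinuousOn (fun z => ‖f z‖ₑ) (ball w r) := hf.continuousOn.enorm
    classical
    have := hc.measurable_piecewise (continuousOn_const (c := (0 : ℝ≥0∞)) (s := (ball w r)ᶜ))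
      measurableSet_ball
    convert this using 1
    ext z
    simp [hF, Set.indicator, Set.piecewise]
  have e1 : ∫⁻ z in ball w r, ‖f z‖ₑ = ∫⁻ z, F (w + z) := by
    rw [lintegral_add_left_eq_self F w, hF, lintegral_indicator measurableSet_ball]
  rw [e1, ← Complex.lintegral_comp_polarCoord_symm, polarCoord_target, Measure.volume_eq_prod,
    ← Measure.prod_restrict]
  have hms : Measurable fun p : ℝ × ℝ => Complex.polarCoord.symm p := by
    simp only [Complex.polarCoord_symm_apply]
    fun_prop
  rw [lintegral_prod _ (by fun_prop)]
  rw [discMass, ← lintegral_const_mul _ (by fun_prop)]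
  refine le_trans ?_ (lintegral_mono_set (s := Set.Ioo 0 r) (fun s hs => hs.1))
  refine setLIntegral_mono' measurableSet_Ioo fun s hs => ?_
  simp only [smul_eq_mul]
  rw [lintegral_const_mul _ (by fun_prop)]
  have h := enorm_le_lintegral_circle hs.1 hs.2 hf
  calc ‖f w‖ₑ * (ENNReal.ofReal s * ENNReal.ofReal (2 * Real.pi))
      = ENNReal.ofReal s * (ENNReal.ofReal (2 * Real.pi) * ‖f w‖ₑ) := by ring
    _ ≤ _ := by
        refine mul_le_mul_right (h.trans (le_of_eq ?_)) _
        refine lintegral_congr fun θ => ?_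
        rw [hF, Set.indicator_of_mem]
        rw [mem_ball, dist_eq_norm, add_sub_cancel_left, Complex.norm_polarCoord_symm,
          abs_of_pos hs.1]
        exact hs.2

theorem discMass_ne_top (r : ℝ) : discMass r ≠ ⊤ := by
  have h := enorm_mul_discMass_le (f := fun _ => (1 : ℂ)) (w := 0) (r := r)
    (differentiableOn_const 1)
  simp only [enorm_one, one_mul, lintegral_const, MeasurableSet.univ, Measure.restrict_apply,
    Set.univ_inter] at h
  exact (h.trans_lt measure_ball_lt_top).ne

/-- Point evaluations are bounded in the `L²` norm. -/
theorem enorm_sq_mul_discMass_le {Ω : Set ℂ} {f : ℂ → ℂ} {w : ℂ} {r : ℝ}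
    (hf : DifferentiableOn ℂ f Ω) (hr : ball w r ⊆ Ω) :
    ‖f w‖ₑ ^ 2 * discMass r ≤ eLpNorm f 2 (volume.restrict Ω) ^ 2 := by
  have h := enorm_mul_discMass_le (f := fun z => f z ^ 2) ((hf.mono hr).pow 2)
  simp only [enorm_pow] at h
  refine h.trans ((lintegral_mono_set hr).trans (le_of_eq ?_))
  have := eLpNorm_nnreal_pow_eq_lintegral (μ := volume.restrict Ω) (f := f) (p := 2) (by norm_num)
  norm_num at this
  exact_mod_cast this.symm

/-- Holomorphic functions on an open set that agree almost everywhere agree. -/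
theorem eqOn_of_ae_eq {Ω : Set ℂ} (hΩ : IsOpen Ω) {f g : ℂ → ℂ} (hf : DifferentiableOn ℂ f Ω)
    (hg : DifferentiableOn ℂ g Ω) (h : f =ᵐ[volume.restrict Ω] g) : Set.EqOn f g Ω := by
  intro w hw
  obtain ⟨r, hr, hrΩ⟩ := Metric.isOpen_iff.1 hΩ w hw
  have h1 := enorm_sq_mul_discMass_le (hf.sub hg) hrΩ
  have h0 : eLpNorm (f - g) 2 (volume.restrict Ω) = 0 := by
    rw [eLpNorm_congr_ae (g := 0) (by filter_upwards [h] with z hz; simp [hz])]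
    simp
  rw [h0] at h1
  have h2 : ‖(f - g) w‖ₑ ^ 2 * discMass r = 0 := by simpa using h1
  rcases mul_eq_zero.1 h2 with h3 | h3
  · exact sub_eq_zero.1 (by simpa using h3)
  · exact absurd h3 (discMass_ne_zero hr)

/-- The Bergman space as a subspace of `L²(Ω)`. -/
def bergmanSubmodule (Ω : Set ℂ) : Submodule ℂ (Lp ℂ 2 (volume.restrict Ω)) where
  carrier := {f | ∃ g : ℂ → ℂ, DifferentiableOn ℂ g Ω ∧ f =ᵐ[volume.restrict Ω] g}
  add_mem' := by
    rintro a b ⟨g, hg, hag⟩ ⟨k, hk, hbk⟩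
    exact ⟨g + k, hg.add hk, (Lp.coeFn_add a b).trans (hag.add hbk)⟩
  zero_mem' := ⟨0, differentiableOn_const 0, Lp.coeFn_zero _ _ _⟩
  smul_mem' := by
    rintro c a ⟨g, hg, hag⟩
    exact ⟨c • g, hg.const_smul c, (Lp.coeFn_smul c a).trans (hag.const_smul c)⟩

theorem isClosed_bergmanSubmodule {Ω : Set ℂ} (hΩ : IsOpen Ω) :
    IsClosed (bergmanSubmodule Ω : Set (Lp ℂ 2 (volume.restrict Ω))) := by
  refine IsSeqClosed.isClosed fun u f hu huf => ?_
  choose g hg hug using hu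
  have hloc : ∀ w ∈ Ω, ∃ r > 0, ball w r ⊆ Ω ∧
      UniformCauchySeqOn g Filter.atTop (ball w r) := by
    intro w hw
    obtain ⟨R, hR, hRΩ⟩ := Metric.isOpen_iff.1 hΩ w hw
    refine ⟨R / 2, by positivity, (ball_subset_ball (by linarith)).trans hRΩ, ?_⟩
    have hc := huf.cauchySeq
    rw [Metric.uniformCauchySeqOn_iff]
    intro ε hε
    have hm := discMass_ne_zero (half_pos hR)
    have hmt := discMass_ne_top (R / 2)
    set m : ℝ := (discMass (R / 2)).toReal with hmdef
    have hmpos : 0 < m := ENNReal.toReal_pos hm hmt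
    obtain ⟨N, hN⟩ := Metric.cauchySeq_iff.1 hc (ε * Real.sqrt m) (by positivity)
    refine ⟨N, fun i hi j hj z hz => ?_⟩
    have hzΩ : ball z (R / 2) ⊆ Ω := by
      refine subset_trans (ball_subset_ball' ?_) hRΩ
      have := mem_ball.1 hz
      linarith
    have h1 := enorm_sq_mul_discMass_le ((hg i).sub (hg j)) hzΩ
    have h2 : eLpNorm (g i - g j) 2 (volume.restrict Ω) = ‖u i - u j‖ₑ := by
      rw [Lp.enorm_def]
      refine eLpNorm_congr_ae ?_
      filter_upwards [hug i, hug j, Lp.coeFn_sub (u i) (u j)] with x h1 h2 h3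
      rw [h3, Pi.sub_apply, Pi.sub_apply, h1, h2]
    rw [h2] at h1
    have h3 := ENNReal.toReal_mono (by simp) h1
    simp only [ENNReal.toReal_mul, ENNReal.toReal_pow, toReal_enorm, Pi.sub_apply] at h3
    rw [← hmdef] at h3
    have h4 := hN i hi j hj
    rw [dist_eq_norm] at h4 ⊢
    have h5 : ‖u i - u j‖ ^ 2 < (ε * Real.sqrt m) ^ 2 :=
      pow_lt_pow_left₀ h4 (norm_nonneg _) two_ne_zero
    rw [mul_pow, Real.sq_sqrt hmpos.le] at h5
    have h6 : ‖g i z - g j z‖ ^ 2 < ε ^ 2 := lt_of_mul_lt_mul_right (h3.trans_lt h5) hmpos.le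
    exact lt_of_pow_lt_pow_left₀ 2 hε.le h6
  have hpt : ∀ w, ∃ l, w ∈ Ω → Filter.Tendsto (fun n => g n w) Filter.atTop (nhds l) := by
    intro w
    by_cases hw : w ∈ Ω
    · obtain ⟨r, hr, -, hc⟩ := hloc w hw
      obtain ⟨l, hl⟩ := cauchySeq_tendsto_of_complete (hc.cauchySeq (mem_ball_self hr))
      exact ⟨l, fun _ => hl⟩
    · exact ⟨0, fun h => absurd h hw⟩
  choose G hG using hpt
  have hlu : TendstoLocallyUniformlyOn g G Filter.atTop Ω := by
    refine tendstoLocallyUniformlyOn_of_forall_exists_nhds fun w hw => ?_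
    obtain ⟨r, hr, hrΩ, hc⟩ := hloc w hw
    exact ⟨ball w r, mem_nhdsWithin_of_mem_nhds (ball_mem_nhds w hr),
      hc.tendstoUniformlyOn_of_tendsto fun z hz => hG z (hrΩ hz)⟩
  refine ⟨G, hlu.differentiableOn (Filter.Eventually.of_forall hg) hΩ, ?_⟩
  have hmeas : TendstoInMeasure (volume.restrict Ω) (fun n => (u n : ℂ → ℂ)) Filter.atTop f :=
    tendstoInMeasure_of_tendsto_Lp huf
  obtain ⟨ns, hns, hae⟩ := hmeas.exists_seq_tendsto_ae
  have hall : ∀ᵐ z ∂(volume.restrict Ω), ∀ n, u n z = g n z := ae_all_iff.2 hug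
  filter_upwards [hae, hall, ae_restrict_mem hΩ.measurableSet] with z h1 h2 h3
  refine tendsto_nhds_unique h1 ?_
  simp only [h2]
  exact (hG z h3).comp hns.tendsto_atTop

theorem exists_isReproducingAt {Ω : Set ℂ} (hΩ : IsOpen Ω) {w : ℂ} (hw : w ∈ Ω) :
    ∃ k, IsReproducingAt Ω w k := by
  obtain ⟨r, hr, hrΩ⟩ := Metric.isOpen_iff.1 hΩ w hw
  have hmem : ∀ f : bergmanSubmodule Ω, ∃ g : ℂ → ℂ, DifferentiableOn ℂ g Ω ∧
      (f : Lp ℂ 2 (volume.restrict Ω)) =ᵐ[volume.restrict Ω] g := fun f => f.2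
  choose g hg hfg using hmem
  let ev : bergmanSubmodule Ω →ₗ[ℂ] ℂ :=
    { toFun := fun f => g f w
      map_add' := fun a b => by
        refine eqOn_of_ae_eq hΩ (hg (a + b)) ((hg a).add (hg b)) ?_ hw
        exact (hfg (a + b)).symm.trans
          ((Lp.coeFn_add (a : Lp ℂ 2 (volume.restrict Ω)) b).trans ((hfg a).add (hfg b)))
      map_smul' := fun c a => by
        refine eqOn_of_ae_eq hΩ (hg (c • a)) ((hg a).const_smul c) ?_ hw
        exact (hfg (c • a)).symm.trans
          ((Lp.coeFn_smul c (a : Lp ℂ 2 (volume.restrict Ω))).trans ((hfg a).const_smul c)) }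
  have hm := discMass_ne_zero hr
  have hbound : ∃ C : ℝ, ∀ f, ‖ev f‖ ≤ C * ‖f‖ := by
    have hmt := discMass_ne_top r
    have hmpos : 0 < (discMass r).toReal := ENNReal.toReal_pos hm hmt
    refine ⟨(Real.sqrt (discMass r).toReal)⁻¹, fun f => ?_⟩
    have h1 := enorm_sq_mul_discMass_le (hg f) hrΩ
    rw [← eLpNorm_congr_ae (hfg f), ← Lp.enorm_def] at h1
    have h3 := ENNReal.toReal_mono (by simp) h1
    simp only [ENNReal.toReal_mul, ENNReal.toReal_pow, toReal_enorm] at h3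
    rw [inv_mul_eq_div, le_div_iff₀ (by positivity)]
    refine le_of_sq_le_sq ?_ (norm_nonneg _)
    rw [mul_pow, Real.sq_sqrt hmpos.le]
    exact h3
  obtain ⟨C, hC⟩ := hbound
  have : CompleteSpace (bergmanSubmodule Ω) :=
    (isClosed_bergmanSubmodule hΩ).completeSpace_coe
  let L : bergmanSubmodule Ω →L[ℂ] ℂ := ev.mkContinuous C hC
  let k := (InnerProductSpace.toDual ℂ (bergmanSubmodule Ω)).symm L
  refine ⟨g k, ⟨hg k, (memLp_congr_ae (hfg k)).1 (Lp.memLp _)⟩, fun f hf => ?_⟩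
  have hfae := hf.2.coeFn_toLp
  let F : bergmanSubmodule Ω := ⟨hf.2.toLp f, f, hf.1, hfae⟩
  have h1 : f w = L F :=
    eqOn_of_ae_eq hΩ hf.1 (hg F) (hfae.symm.trans (hfg F)) hw
  have h2 : inner ℂ k F = L F := InnerProductSpace.toDual_symm_apply
  rw [h1, ← h2, Submodule.coe_inner, L2.inner_def]
  refine integral_congr_ae ?_
  filter_upwards [hfae, hfg k] with z hz1 hz2
  rw [hz2]
  change inner ℂ (g k z) (hf.2.toLp f z) = _
  rw [hz1, RCLike.inner_apply]

/-- On an open set the Bergman kernel has its defining property. -/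
theorem bergmanKernel_spec {Ω : Set ℂ} (hΩ : IsOpen Ω) {w : ℂ} (hw : w ∈ Ω) :
    IsReproducingAt Ω w fun z => bergmanKernel Ω z w := by
  have h := exists_isReproducingAt hΩ hw
  have e : (fun z => bergmanKernel Ω z w) = h.choose := by
    funext z
    simp only [bergmanKernel, dif_pos h]
  rw [e]
  exact h.choose_spec

/-- The representing function is unique on `Ω`. -/
theorem IsReproducingAt.eqOn {Ω : Set ℂ} (hΩ : IsOpen Ω) {w : ℂ} {k l : ℂ → ℂ}
    (hk : IsReproducingAt Ω w k) (hl : IsReproducingAt Ω w l) : Set.EqOn k l Ω := by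
  refine eqOn_of_ae_eq hΩ hk.1.1 hl.1.1 ?_
  have hd : MemBergman Ω (k - l) := ⟨hk.1.1.sub hl.1.1, hk.1.2.sub hl.1.2⟩
  have hint : ∀ m, MemBergman Ω m →
      Integrable (fun z => (k - l) z * conj (m z)) (volume.restrict Ω) := fun m hm =>
    MemLp.integrable_mul hd.2 hm.2.star
  have h0 : ∫ z in Ω, (k - l) z * conj ((k - l) z) = 0 := by
    have h1 := (hk.2 _ hd).symm.trans (hl.2 _ hd)
    rw [← sub_eq_zero, ← integral_sub (hint k hk.1) (hint l hl.1)] at h1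
    rw [← h1]
    refine integral_congr_ae (Filter.Eventually.of_forall fun z => ?_)
    simp only [Pi.sub_apply, map_sub]
    ring
  have hsq : Integrable (fun z => ‖(k - l) z‖ ^ 2) (volume.restrict Ω) :=
    (memLp_two_iff_integrable_sq_norm hd.2.aestronglyMeasurable).1 hd.2
  have h2 : ∫ z in Ω, ‖(k - l) z‖ ^ 2 = 0 := by
    have : (∫ z in Ω, ((‖(k - l) z‖ ^ 2 : ℝ) : ℂ)) = 0 := by
      rw [← h0]
      refine integral_congr_ae (Filter.Eventually.of_forall fun z => ?_)
      simp only [Complex.mul_conj, Complex.normSq_eq_norm_sq]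
    rw [integral_complex_ofReal] at this
    exact_mod_cast this
  rw [integral_eq_zero_iff_of_nonneg (fun z => by positivity) hsq] at h2
  filter_upwards [h2] with z hz
  exact sub_eq_zero.1 (by simpa using hz)

end

/-! Let k = K_Ω(·, w), and let `dz` be ∂ₓ - i∂_y, so that |`dz` η| = |∇η| for real η. By Weyl's
lemma an L² function orthogonal to every `dz φ`, φ a test function, is holomorphic. Evaluation at w
is also represented by a function χ supported in a small disc: the kernel of the disc, extended by
zero. Hence χ - k is orthogonal to A²(Ω) and is an L² limit of functions `dz φ`
(`exists_eLpNorm_sub_dz_lt`).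

The heart is the weighted estimate `eLpNorm_weight_mul_dz_le`. Let η be a weight with |∇η| ≤ τη/δ,
and put P = dz(ηφ), Q = φ dz η. Then η dz φ = P - Q, while dz(η²φ) = η(P + Q) is orthogonal to k. So
⟨P + Q, P - Q⟩ = ⟨P + Q, Y⟩ with Y = η(k + dz φ), which is close to ηχ. Hardy's inequality gives
3‖Q‖ ≤ ‖P‖ as soon as 3τ ≤ h(Ω); it extends to complex φ because Jacobians of compactly supported
maps integrate to zero. Since Re⟨P + Q, P - Q⟩ = ‖P‖² - ‖Q‖², the term Q is absorbed, and ‖ηk‖ ≤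
3‖ηχ‖ with no dependence on sup η. Weights approximating δ^(-τ) (`exists_weights`) and Fatou's lemma
yield ∫|k|²δ^(-2τ) < ∞.

The mean value inequality on discs of radius δ/2 turns this into |k| ≤ Cδ^(τ-1). For τ = 1 - 2/p it
follows that |k|^p = |k|^(p-2)|k|² is bounded by a constant times |k|²δ^(-2τ), so k is in L^p. For h
< 3 the condition 3(1 - 2/p) ≤ h reads p ≤ 6/(3 - h). -/

noncomputable section

/-! ### Wirtinger derivatives -/

/-- The operator `∂ₓ - i ∂_y` (twice the usual Wirtinger derivative `∂/∂z`). -/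
def dz (φ : ℂ → ℂ) (z : ℂ) : ℂ := fderiv ℝ φ z 1 - Complex.I * fderiv ℝ φ z Complex.I

/-- The operator `∂ₓ + i ∂_y` (twice the usual Wirtinger derivative `∂/∂z̄`). -/
def dbar (φ : ℂ → ℂ) (z : ℂ) : ℂ := fderiv ℝ φ z 1 + Complex.I * fderiv ℝ φ z Complex.I

/-- Complex-valued smooth functions with compact support contained in `Ω`. -/
structure IsComplexTest (Ω : Set ℂ) (φ : ℂ → ℂ) : Prop where
  contDiff : ContDiff ℝ ∞ φ
  hasCompactSupport : HasCompactSupport φ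
  tsupport_subset : tsupport φ ⊆ Ω

/-- Turns orthogonality to the functions `dz φ` into the weak Cauchy-Riemann equation. -/
theorem conj_dz {φ : ℂ → ℂ} {z : ℂ} (hφ : DifferentiableAt ℝ φ z) :
    conj (dz φ z) = dbar (fun z => conj (φ z)) z := by
  have h : HasFDerivAt (fun z => conj (φ z))
      ((Complex.conjCLE : ℂ →L[ℝ] ℂ).comp (fderiv ℝ φ z)) z :=
    (Complex.conjCLE : ℂ →L[ℝ] ℂ).hasFDerivAt.comp z hφ.hasFDerivAt
  simp [dz, dbar, h.fderiv]

theorem dz_mul {φ ψ : ℂ → ℂ} {z : ℂ} (hφ : DifferentiableAt ℝ φ z) (hψ : DifferentiableAt ℝ ψ z) :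
    dz (fun z => φ z * ψ z) z = φ z * dz ψ z + ψ z * dz φ z := by
  simp only [dz]
  rw [fderiv_fun_mul hφ hψ]
  simp
  ring

theorem dz_add {φ ψ : ℂ → ℂ} {z : ℂ} (hφ : DifferentiableAt ℝ φ z) (hψ : DifferentiableAt ℝ ψ z) :
    dz (φ + ψ) z = dz φ z + dz ψ z := by
  simp only [dz]
  rw [fderiv_add hφ hψ]
  simp
  ring

theorem dz_const_smul {φ : ℂ → ℂ} {z : ℂ} (c : ℂ) (hφ : DifferentiableAt ℝ φ z) :
    dz (c • φ) z = c * dz φ z := by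
  simp only [dz]
  rw [fderiv_const_smul hφ]
  simp
  ring

theorem support_fderiv_apply_subset {φ : ℂ → ℂ} (v : ℂ) :
    Function.support (fun z => fderiv ℝ φ z v) ⊆ tsupport φ := fun z hz => by
  refine support_fderiv_subset ℝ fun h => hz ?_
  simp [h]

theorem support_dz_subset (φ : ℂ → ℂ) : Function.support (dz φ) ⊆ tsupport φ := by
  intro z hz
  refine support_fderiv_subset ℝ fun h => hz ?_
  simp [dz, h]

theorem support_dbar_subset (φ : ℂ → ℂ) : Function.support (dbar φ) ⊆ tsupport φ := by
  intro z hz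
  refine support_fderiv_subset ℝ fun h => hz ?_
  simp [dbar, h]

namespace IsComplexTest

variable {Ω : Set ℂ} {φ ψ : ℂ → ℂ}

theorem differentiable (h : IsComplexTest Ω φ) : Differentiable ℝ φ :=
  h.contDiff.differentiable (by simp)

theorem continuous_fderiv_apply (h : IsComplexTest Ω φ) (v : ℂ) :
    Continuous fun z => fderiv ℝ φ z v :=
  (h.contDiff.continuous_fderiv (by simp)).clm_apply continuous_const

theorem continuous_dz (h : IsComplexTest Ω φ) : Continuous (dz φ) :=
  (h.continuous_fderiv_apply 1).sub (continuous_const.mul (h.continuous_fderiv_apply _))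

theorem zero (Ω : Set ℂ) : IsComplexTest Ω 0 :=
  ⟨contDiff_const, HasCompactSupport.zero, by simp [tsupport]⟩

theorem add (h : IsComplexTest Ω φ) (h' : IsComplexTest Ω ψ) : IsComplexTest Ω (φ + ψ) :=
  ⟨h.contDiff.add h'.contDiff, h.hasCompactSupport.add h'.hasCompactSupport,
    (tsupport_add φ ψ).trans (Set.union_subset h.tsupport_subset h'.tsupport_subset)⟩

theorem mul_left (h : IsComplexTest Ω φ) {η : ℂ → ℂ} (hη : ContDiff ℝ ∞ η) :
    IsComplexTest Ω fun z => η z * φ z :=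
  ⟨hη.mul h.contDiff, h.hasCompactSupport.mul_left,
    (closure_mono (Function.support_mul_subset_right _ _)).trans h.tsupport_subset⟩

theorem const_smul (h : IsComplexTest Ω φ) (c : ℂ) : IsComplexTest Ω (c • φ) :=
  h.mul_left (η := fun _ => c) contDiff_const

theorem star (h : IsComplexTest Ω φ) : IsComplexTest Ω fun z => conj (φ z) := by
  refine ⟨Complex.conjCLE.contDiff.comp h.contDiff, h.hasCompactSupport.comp_left (map_zero _), ?_⟩
  exact (closure_mono (Function.support_comp_subset (map_zero (starRingEnd ℂ)) φ)).trans
    h.tsupport_subset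

end IsComplexTest

/-- A function continuous on `Ω` times a continuous function vanishing off a compact subset
of `Ω` is integrable. -/
theorem integrable_mul_of_support_subset {Ω K : Set ℂ} {k u : ℂ → ℂ} (hk : ContinuousOn k Ω)
    (hu : Continuous u) (hK : IsCompact K) (hKΩ : K ⊆ Ω) (hs : Function.support u ⊆ K) :
    Integrable fun z => k z * u z := by
  have h : IntegrableOn (fun z => k z * u z) K :=
    ((hk.mono hKΩ).mul hu.continuousOn).integrableOn_compact hK
  refine (integrableOn_iff_integrable_of_support_subset ?_).1 h
  exact (Function.support_mul_subset_right _ _).trans hs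

/-- Holomorphic functions are weak solutions of the Cauchy-Riemann equation. -/
theorem integral_mul_dbar_eq_zero {Ω : Set ℂ} (hΩ : IsOpen Ω) {k g : ℂ → ℂ}
    (hk : DifferentiableOn ℂ k Ω) (hg : IsComplexTest Ω g) :
    ∫ z, k z * dbar g z = 0 := by
  have hkd : ∀ z ∈ Ω, DifferentiableAt ℂ k z := fun z hz => hk.differentiableAt (hΩ.mem_nhds hz)
  have hkf : ∀ z ∈ Ω, fderiv ℝ k z = (fderiv ℂ k z).restrictScalars ℝ := fun z hz =>
    (hkd z hz).fderiv_restrictScalars ℝ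
  have hK : IsCompact (tsupport g) := hg.hasCompactSupport
  have hc' : ∀ v : ℂ, ContinuousOn (fun z => fderiv ℝ k z v) Ω := fun v => by
    have h1 : ContinuousOn (fderiv ℂ k) Ω := by
      have := (hk.contDiffOn (n := 1) hΩ).continuousOn_fderiv_of_isOpen hΩ le_rfl
      exact this
    refine ContinuousOn.congr (h1.clm_apply (continuousOn_const (c := v))) fun z hz => ?_
    rw [hkf z hz]
    rfl
  have i1 : ∀ v, Integrable fun z => fderiv ℝ k z v * g z := fun v =>
    integrable_mul_of_support_subset (hc' v) hg.contDiff.continuous hK hg.tsupport_subset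
      (subset_tsupport g)
  have i2 : ∀ v, Integrable fun z => k z * fderiv ℝ g z v := fun v =>
    integrable_mul_of_support_subset hk.continuousOn (hg.continuous_fderiv_apply v) hK
      hg.tsupport_subset (support_fderiv_apply_subset v)
  have i3 : Integrable fun z => k z * g z :=
    integrable_mul_of_support_subset hk.continuousOn hg.contDiff.continuous hK hg.tsupport_subset
      (subset_tsupport g)
  have ibp : ∀ v, ∫ z, k z * fderiv ℝ g z v = -∫ z, fderiv ℝ k z v * g z := fun v =>
    integral_mul_fderiv_eq_neg_fderiv_mul_of_integrable (i1 v) (i2 v) i3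
      (fun z hz => (hkd z (hg.tsupport_subset hz)).restrictScalars ℝ)
      (fun z _ => hg.differentiable z)
  have e : (fun z => k z * dbar g z) = fun z =>
      k z * fderiv ℝ g z 1 + Complex.I * (k z * fderiv ℝ g z Complex.I) := by
    funext z
    simp only [dbar]
    ring
  rw [e, integral_add (i2 1) ((i2 _).const_mul _), integral_const_mul, ibp, ibp, mul_neg,
    ← integral_const_mul, ← neg_add, ← integral_add (i1 1) ((i1 _).const_mul _), neg_eq_zero]
  -- The integrand is now g times `dbar k`: the Cauchy-Riemann equations kill it on Ω, and g
  -- vanishes elsewhere.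
  refine integral_eq_zero_of_ae (Filter.Eventually.of_forall fun z => ?_)
  by_cases hz : z ∈ Ω
  · have : fderiv ℂ k z Complex.I = Complex.I * fderiv ℂ k z 1 := by
      conv_lhs => rw [← mul_one Complex.I, ← smul_eq_mul, map_smul, smul_eq_mul]
    change fderiv ℝ k z 1 * g z + Complex.I * (fderiv ℝ k z Complex.I * g z) = 0
    simp only [hkf z hz, ContinuousLinearMap.coe_restrictScalars', this]
    linear_combination (fderiv ℂ k z 1 * g z) * Complex.I_mul_I
  · have : g z = 0 := image_eq_zero_of_notMem_tsupport fun h => hz (hg.tsupport_subset h)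
    simp [this]

/-- A real-differentiable function with `dbar f = 0` is holomorphic. -/
theorem differentiableAt_of_dbar_eq_zero {f : ℂ → ℂ} {z : ℂ} (hf : DifferentiableAt ℝ f z)
    (h : dbar f z = 0) : DifferentiableAt ℂ f z := by
  refine differentiableAt_complex_iff_differentiableAt_real.2 ⟨hf, ?_⟩
  simp only [dbar] at h
  rw [smul_eq_mul]
  linear_combination (-Complex.I) * h + (fderiv ℝ f z Complex.I) * Complex.I_mul_I

/-! ### Weyl's lemma for the Cauchy-Riemann operator -/

/-- An almost everywhere limit of uniformly bounded holomorphic functions on a disc is almost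
everywhere equal to a holomorphic function. -/
theorem exists_differentiableOn_of_tendsto_ae {w : ℂ} {r M : ℝ} {u : ℕ → ℂ → ℂ} {f : ℂ → ℂ}
    (hu : ∀ n, DifferentiableOn ℂ (u n) (ball w r)) (hM : ∀ n, ∀ z ∈ ball w r, ‖u n z‖ ≤ M)
    (hf : ∀ᵐ z ∂volume.restrict (ball w r),
      Filter.Tendsto (fun n => u n z) Filter.atTop (nhds (f z))) :
    ∃ g, DifferentiableOn ℂ g (ball w r) ∧ f =ᵐ[volume.restrict (ball w r)] g := by
  have : IsFiniteMeasure (volume.restrict (ball w r)) :=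
    ⟨by rw [Measure.restrict_apply_univ]; exact measure_ball_lt_top⟩
  have hmeas : ∀ n, AEStronglyMeasurable (u n) (volume.restrict (ball w r)) := fun n =>
    (hu n).continuousOn.aestronglyMeasurable measurableSet_ball
  have hbd : ∀ n, ∀ᵐ z ∂volume.restrict (ball w r), ‖u n z‖ ≤ M := fun n =>
    ae_restrict_of_forall_mem measurableSet_ball (hM n)
  have hmem : ∀ n, MemLp (u n) 2 (volume.restrict (ball w r)) := fun n =>
    MemLp.of_bound (hmeas n) M (hbd n)
  have hfm : MemLp f 2 (volume.restrict (ball w r)) := by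
    refine MemLp.of_bound (aestronglyMeasurable_of_tendsto_ae _ hmeas hf) M ?_
    filter_upwards [hf, ae_all_iff.2 hbd] with z h1 h2
    exact le_of_tendsto h1.norm (Filter.Eventually.of_forall h2)
  -- Nothing survives truncation above M + 1, so Vitali's theorem upgrades the convergence to L²,
  -- where holomorphic functions form a closed subspace.
  have hui : UnifIntegrable u 2 (volume.restrict (ball w r)) := by
    refine unifIntegrable_of (by norm_num) (by norm_num) hmeas fun ε _ => ?_
    refine ⟨M.toNNReal + 1, fun n => ?_⟩
    rw [eLpNorm_congr_ae (g := 0)]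
    · simp
    · filter_upwards [hbd n] with z hz
      refine Set.indicator_of_notMem (fun h => ?_) _
      have h1 : ((M.toNNReal + 1 : ℝ≥0) : ℝ) ≤ ‖u n z‖ := h
      have h2 := Real.le_coe_toNNReal M
      push_cast at h1
      linarith
  have htend := tendsto_Lp_finite_of_tendsto_ae (by norm_num) (by norm_num) hmeas hfm hui hf
  rw [← Lp.tendsto_Lp_iff_tendsto_eLpNorm'' u hmem f hfm] at htend
  have hmemb := (isClosed_bergmanSubmodule (isOpen_ball (x := w) (ε := r))).mem_of_tendsto htend
    (Filter.Eventually.of_forall fun n => ⟨u n, hu n, (hmem n).coeFn_toLp⟩)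
  obtain ⟨g, hg, hfg⟩ := hmemb
  exact ⟨g, hg, hfm.coeFn_toLp.symm.trans hfg⟩

/-- Convolution with a probability density does not increase the `L¹` norm. -/
theorem lintegral_enorm_convolution_le (φ : ContDiffBump (0 : ℂ)) {F : ℂ → ℂ}
    (hF : Integrable F) :
    ∫⁻ x, ‖(convolution (φ.normed volume) F (ContinuousLinearMap.lsmul ℝ ℝ) volume) x‖ₑ ≤
      ∫⁻ x, ‖F x‖ₑ := by
  have h1 : ∀ x, ‖(convolution (φ.normed volume) F (ContinuousLinearMap.lsmul ℝ ℝ) volume) x‖ₑ ≤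
      ∫⁻ t, ‖φ.normed volume t‖ₑ * ‖F (x - t)‖ₑ := fun x => by
    refine (enorm_integral_le_lintegral_enorm _).trans (le_of_eq ?_)
    refine lintegral_congr fun t => ?_
    rw [ContinuousLinearMap.lsmul_apply, enorm_smul]
  refine (lintegral_mono h1).trans ?_
  have hm : AEMeasurable (Function.uncurry fun x t : ℂ => ‖φ.normed volume t‖ₑ * ‖F (x - t)‖ₑ)
      (volume.prod volume) := by
    have m1 : AEMeasurable (fun p : ℂ × ℂ => ‖φ.normed volume p.2‖ₑ) (volume.prod volume) :=
      (φ.continuous_normed.measurable.comp measurable_snd).enorm.aemeasurable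
    have m2 : AEMeasurable (fun p : ℂ × ℂ => ‖F (p.1 - p.2)‖ₑ) (volume.prod volume) :=
      (hF.1.aemeasurable.comp_quasiMeasurePreserving
        (quasiMeasurePreserving_sub_of_right_invariant volume volume)).enorm
    exact m1.mul m2
  rw [lintegral_lintegral_swap hm]
  have h2 : ∀ t, ∫⁻ x, ‖φ.normed volume t‖ₑ * ‖F (x - t)‖ₑ =
      ‖φ.normed volume t‖ₑ * ∫⁻ x, ‖F x‖ₑ := fun t => by
    rw [lintegral_const_mul' _ _ enorm_ne_top, lintegral_sub_right_eq_self (fun x => ‖F x‖ₑ) t]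
  simp_rw [h2]
  rw [lintegral_mul_const _ φ.continuous_normed.measurable.enorm]
  have h3 : ∫⁻ t, ‖φ.normed volume t‖ₑ = 1 := by
    rw [← ofReal_integral_norm_eq_lintegral_enorm φ.integrable_normed]
    simp_rw [Real.norm_of_nonneg (φ.nonneg_normed _)]
    rw [φ.integral_normed, ENNReal.ofReal_one]
  rw [h3, one_mul]

/-- The mollification of a weak solution of the Cauchy-Riemann equation is holomorphic. -/
theorem differentiableAt_convolution_of_weak {w x : ℂ} {R : ℝ} {F : ℂ → ℂ} (hF : Integrable F)
    (hweak : ∀ ψ, IsComplexTest (ball w R) ψ → ∫ z, F z * dbar ψ z = 0)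
    (φ : ContDiffBump (0 : ℂ)) (hx : dist x w + φ.rOut < R) :
    DifferentiableAt ℂ
      (convolution (φ.normed volume) F (ContinuousLinearMap.lsmul ℝ ℝ) volume) x := by
  have hsm : ContDiff ℝ 1 (φ.normed volume) := φ.contDiff_normed
  have hsmi : ContDiff ℝ ∞ (φ.normed volume) := φ.contDiff_normed
  rw [← convolution_flip]
  set L := (ContinuousLinearMap.lsmul ℝ ℝ : ℝ →L[ℝ] ℂ →L[ℝ] ℂ).flip with hL
  have hd := φ.hasCompactSupport_normed.hasFDerivAt_convolution_right
    L hF.locallyIntegrable hsm x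
  refine differentiableAt_of_dbar_eq_zero hd.differentiableAt ?_
  -- Derivatives of the convolution fall on the mollifier, so its `dbar` at x is minus the pairing
  -- of F with `dbar ψ`. By `hx` this ψ is an admissible test function.
  set ψ : ℂ → ℂ := fun t => ((φ.normed volume (x - t) : ℝ) : ℂ) with hψ
  have hψt : IsComplexTest (ball w R) ψ := by
    have hsupp : Function.support ψ ⊆ closedBall x φ.rOut := fun t ht => by
      have h1 : x - t ∈ Function.support (φ.normed volume) := fun h => ht (by simp [hψ, h])
      rw [φ.support_normed_eq, mem_ball_zero_iff] at h1
      rw [mem_closedBall, dist_comm, dist_eq_norm]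
      exact h1.le
    have hts : tsupport ψ ⊆ closedBall x φ.rOut := closure_minimal hsupp isClosed_closedBall
    refine ⟨?_, ?_, ?_⟩
    · exact Complex.ofRealCLM.contDiff.comp (hsmi.comp (contDiff_const.sub contDiff_id))
    · exact (isCompact_closedBall x φ.rOut).of_isClosed_subset (isClosed_tsupport ψ) hts
    · refine hts.trans (closedBall_subset_ball' ?_)
      linarith
  have hψd : ∀ t v, fderiv ℝ ψ t v = -((fderiv ℝ (φ.normed volume) (x - t) v : ℝ) : ℂ) := by
    intro t v
    have h1 : HasFDerivAt (fun t : ℂ => x - t) (-ContinuousLinearMap.id ℝ ℂ) t :=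
      (hasFDerivAt_id t).const_sub x
    have h2 : HasFDerivAt (φ.normed volume) (fderiv ℝ (φ.normed volume) (x - t)) (x - t) :=
      (hsm.differentiable one_ne_zero).differentiableAt.hasFDerivAt
    have h3 := Complex.ofRealCLM.hasFDerivAt.comp t (h2.comp t h1)
    have h4 : fderiv ℝ ψ t = _ := h3.fderiv
    rw [h4]
    simp
  have hcomp : ∀ v, fderiv ℝ (convolution F (φ.normed volume) L volume) x v =
      -∫ t, F t * fderiv ℝ ψ t v := by
    intro v
    rw [hd.fderiv, convolution_precompR_apply L hF.locallyIntegrable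
      (φ.hasCompactSupport_normed.fderiv ℝ) (hsm.continuous_fderiv one_ne_zero), convolution_def,
      ← integral_neg]
    refine integral_congr_ae (Filter.Eventually.of_forall fun t => ?_)
    simp only [hψd, hL, ContinuousLinearMap.flip_apply, ContinuousLinearMap.lsmul_apply,
      Complex.real_smul]
    ring
  have hi : ∀ v, Integrable fun t => F t * fderiv ℝ ψ t v := fun v => by
    obtain ⟨C, hC⟩ := (hψt.continuous_fderiv_apply v).bounded_above_of_compact_support
      (hψt.hasCompactSupport.mono' (support_fderiv_apply_subset v))
    exact hF.mul_bdd (c := C) (hψt.continuous_fderiv_apply v).aestronglyMeasurable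
      (Filter.Eventually.of_forall hC)
  have h0 := hweak ψ hψt
  have e : (fun z => F z * dbar ψ z) = fun z =>
      F z * fderiv ℝ ψ z 1 + Complex.I * (F z * fderiv ℝ ψ z Complex.I) := by
    funext z
    simp only [dbar]
    ring
  rw [e, integral_add (hi 1) ((hi _).const_mul _), integral_const_mul] at h0
  simp only [dbar]
  rw [hcomp, hcomp]
  linear_combination -h0

/-- Local form of Weyl's lemma for the Cauchy-Riemann operator. -/
theorem exists_differentiableOn_ball_of_weak {w : ℂ} {r : ℝ} (hr : 0 < r) {F : ℂ → ℂ}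
    (hF : Integrable F)
    (hweak : ∀ ψ, IsComplexTest (ball w (3 * r)) ψ → ∫ z, F z * dbar ψ z = 0) :
    ∃ g, DifferentiableOn ℂ g (ball w r) ∧ F =ᵐ[volume.restrict (ball w r)] g := by
  -- The ratio of outer to inner radius stays equal to 2, as needed for almost everywhere
  -- convergence of the mollifications.
  let φ : ℕ → ContDiffBump (0 : ℂ) := fun n =>
    ⟨r / (2 * (n + 1)), r / (n + 1), by positivity, by gcongr; linarith⟩
  have hφr : ∀ n, (φ n).rOut = r / (n + 1) := fun n => rfl
  have hφle : ∀ n, (φ n).rOut ≤ r := fun n => by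
    rw [hφr]
    exact div_le_self hr.le (by linarith [n.cast_nonneg (α := ℝ)])
  set u : ℕ → ℂ → ℂ := fun n =>
    convolution ((φ n).normed volume) F (ContinuousLinearMap.lsmul ℝ ℝ) volume with hu
  -- Three nested discs: the weak equation on radius 3r and mollifiers of radius at most r give
  -- holomorphy on radius 2r, leaving room for mean value discs of radius r about points of `ball w
  -- r`.
  have hud : ∀ n, DifferentiableOn ℂ (u n) (ball w (2 * r)) := fun n x hx => by
    refine (differentiableAt_convolution_of_weak hF hweak (φ n) ?_).differentiableWithinAt
    have := mem_ball.1 hx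
    linarith [hφle n]
  have hlim : ∀ᵐ x, Filter.Tendsto (fun n => u n x) Filter.atTop (nhds (F x)) := by
    refine ContDiffBump.ae_convolution_tendsto_right_of_locallyIntegrable (K := 2) ?_ ?_
      hF.locallyIntegrable
    · simp only [hφr]
      exact_mod_cast (Filter.tendsto_add_atTop_iff_nat 1).2
        (tendsto_const_div_atTop_nhds_zero_nat r)
    · refine Filter.Eventually.of_forall fun n => ?_
      change r / (n + 1) ≤ 2 * (r / (2 * (n + 1)))
      apply le_of_eq
      field_simp
  have hm := discMass_ne_zero hr
  have hbd : ∀ n, ∀ z ∈ ball w r, ‖u n z‖ ≤ ((∫⁻ x, ‖F x‖ₑ) / discMass r).toReal := by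
    intro n z hz
    have hsub : ball z r ⊆ ball w (2 * r) := ball_subset_ball' (by linarith [mem_ball.1 hz])
    have h1 := enorm_mul_discMass_le ((hud n).mono hsub)
    have h2 := h1.trans ((setLIntegral_le_lintegral _ _).trans
      (lintegral_enorm_convolution_le (φ n) hF))
    rw [← toReal_enorm]
    refine ENNReal.toReal_mono ?_ ?_
    · exact ENNReal.div_ne_top hF.2.ne hm
    · rwa [ENNReal.le_div_iff_mul_le (Or.inl hm) (Or.inl (discMass_ne_top r))]
  exact exists_differentiableOn_of_tendsto_ae
    (fun n => (hud n).mono (ball_subset_ball (by linarith))) hbd (ae_restrict_of_ae hlim)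

/-- A function on an open set that is locally almost everywhere equal to holomorphic functions
is almost everywhere equal to a holomorphic function. -/
theorem exists_differentiableOn_of_locally {Ω : Set ℂ} {f : ℂ → ℂ}
    (h : ∀ w ∈ Ω, ∃ r > 0, ball w r ⊆ Ω ∧ ∃ g, DifferentiableOn ℂ g (ball w r) ∧
      f =ᵐ[volume.restrict (ball w r)] g) :
    ∃ g, DifferentiableOn ℂ g Ω ∧ f =ᵐ[volume.restrict Ω] g := by
  classical
  have h' : ∀ w, ∃ r : ℝ, ∃ g : ℂ → ℂ, w ∈ Ω → 0 < r ∧ ball w r ⊆ Ω ∧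
      DifferentiableOn ℂ g (ball w r) ∧ f =ᵐ[volume.restrict (ball w r)] g := fun w => by
    by_cases hw : w ∈ Ω
    · obtain ⟨r, hr, hrΩ, g, hg⟩ := h w hw
      exact ⟨r, g, fun _ => ⟨hr, hrΩ, hg⟩⟩
    · exact ⟨0, 0, fun h => absurd h hw⟩
  choose r g hg using h'
  -- Local representatives agree almost everywhere, hence everywhere, on overlaps; so z ↦ g z z
  -- glues them.
  have hcompat : ∀ w ∈ Ω, ∀ z ∈ ball w (r w), g z z = g w z := by
    intro w hw z hz
    have hzΩ := (hg w hw).2.1 hz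
    have ho : IsOpen (ball z (r z) ∩ ball w (r w)) := isOpen_ball.inter isOpen_ball
    refine eqOn_of_ae_eq ho ((hg z hzΩ).2.2.1.mono Set.inter_subset_left)
      ((hg w hw).2.2.1.mono Set.inter_subset_right) ?_ ⟨mem_ball_self (hg z hzΩ).1, hz⟩
    filter_upwards [ae_restrict_of_ae_restrict_of_subset Set.inter_subset_left (hg z hzΩ).2.2.2,
      ae_restrict_of_ae_restrict_of_subset Set.inter_subset_right (hg w hw).2.2.2] with x h1 h2
    rw [← h1, h2]
  refine ⟨fun z => g z z, fun w hw => ?_, ?_⟩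
  · have hb : ball w (r w) ∈ nhds w := ball_mem_nhds w (hg w hw).1
    refine DifferentiableAt.differentiableWithinAt ?_
    refine ((hg w hw).2.2.1.differentiableAt hb).congr_of_eventuallyEq ?_
    filter_upwards [hb] with z hz using hcompat w hw z hz
  · have hΩo : IsOpen Ω := Metric.isOpen_iff.2 fun w hw => ⟨r w, (hg w hw).1, (hg w hw).2.1⟩
    rw [Filter.EventuallyEq, ae_restrict_iff' hΩo.measurableSet, ae_iff]
    refine measure_null_of_locally_null _ fun w hw => ?_
    have hwΩ : w ∈ Ω := by
      by_contra hn
      exact hw fun h => absurd h hn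
    refine ⟨_, mem_nhdsWithin_of_mem_nhds (ball_mem_nhds w (hg w hwΩ).1) |> fun h =>
      Filter.inter_mem h self_mem_nhdsWithin, ?_⟩
    have h1 := (hg w hwΩ).2.2.2
    rw [Filter.EventuallyEq, ae_restrict_iff' measurableSet_ball, ae_iff] at h1
    refine measure_mono_null ?_ h1
    rintro z ⟨hz, hz'⟩ hzz
    exact hz' fun _ => by rw [hzz hz, hcompat w hwΩ z hz]

/-- **Weyl's lemma** for the Cauchy-Riemann operator. -/
theorem exists_differentiableOn_of_weak {Ω : Set ℂ} (hΩ : IsOpen Ω) {f : ℂ → ℂ}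
    (hf : MemLp f 2 (volume.restrict Ω))
    (hweak : ∀ ψ, IsComplexTest Ω ψ → ∫ z in Ω, f z * dbar ψ z = 0) :
    ∃ g, DifferentiableOn ℂ g Ω ∧ f =ᵐ[volume.restrict Ω] g := by
  refine exists_differentiableOn_of_locally fun w hw => ?_
  obtain ⟨R, hR, hRΩ⟩ := Metric.isOpen_iff.1 hΩ w hw
  have hr : 0 < R / 3 := by positivity
  have hsub : ball w (R / 3) ⊆ ball w R := ball_subset_ball (by linarith)
  refine ⟨R / 3, hr, hsub.trans hRΩ, ?_⟩
  have : IsFiniteMeasure (volume.restrict (ball w R)) :=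
    ⟨by rw [Measure.restrict_apply_univ]; exact measure_ball_lt_top⟩
  have hint : IntegrableOn f (ball w R) :=
    (hf.mono_measure (Measure.restrict_mono hRΩ le_rfl)).integrable (by norm_num)
  obtain ⟨g, hg, hfg⟩ := exists_differentiableOn_ball_of_weak (w := w) hr
    ((integrable_indicator_iff measurableSet_ball).2 hint) (fun ψ hψ => by
      rw [show 3 * (R / 3) = R by ring] at hψ
      rw [← hweak ψ ⟨hψ.contDiff, hψ.hasCompactSupport, hψ.tsupport_subset.trans hRΩ⟩,
        ← integral_indicator hΩ.measurableSet]
      refine integral_congr_ae (Filter.Eventually.of_forall fun z => ?_)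
      by_cases hz : z ∈ ball w R
      · simp [hz, hRΩ hz]
      · have : dbar ψ z = 0 := by
          by_contra hne
          exact hz (hψ.tsupport_subset (support_dbar_subset ψ hne))
        simp [this, Set.indicator])
  refine ⟨g, hg, ?_⟩
  filter_upwards [hfg, ae_restrict_mem measurableSet_ball] with z h1 h2
  rwa [Set.indicator_of_mem (hsub h2)] at h1

/-! ### The orthogonal complement of the Bergman space -/

theorem IsComplexTest.memLp_dz {Ω : Set ℂ} {φ : ℂ → ℂ} (h : IsComplexTest Ω φ)
    (μ : Measure ℂ) [IsFiniteMeasureOnCompacts μ] : MemLp (dz φ) 2 μ :=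
  h.continuous_dz.memLp_of_hasCompactSupport
    (h.hasCompactSupport.mono' (support_dz_subset φ))

/-- The subspace `{dz φ : φ ∈ C₀^∞(Ω)}` of `L²(Ω)`. -/
def dzRange (Ω : Set ℂ) : Submodule ℂ (Lp ℂ 2 (volume.restrict Ω)) where
  carrier := {F | ∃ φ, IsComplexTest Ω φ ∧ F =ᵐ[volume.restrict Ω] dz φ}
  add_mem' := by
    rintro a b ⟨φ, hφ, ha⟩ ⟨ψ, hψ, hb⟩
    refine ⟨φ + ψ, hφ.add hψ, (Lp.coeFn_add a b).trans ?_⟩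
    filter_upwards [ha, hb] with z h1 h2
    rw [dz_add (hφ.differentiable z) (hψ.differentiable z), Pi.add_apply, h1, h2]
  zero_mem' := by
    refine ⟨0, IsComplexTest.zero Ω, (Lp.coeFn_zero _ _ _).trans ?_⟩
    refine Filter.Eventually.of_forall fun z => ?_
    simp [dz]
  smul_mem' := by
    rintro c a ⟨φ, hφ, ha⟩
    refine ⟨c • φ, hφ.const_smul c, (Lp.coeFn_smul c a).trans ?_⟩
    filter_upwards [ha] with z h1
    rw [dz_const_smul c (hφ.differentiable z), Pi.smul_apply, h1, smul_eq_mul]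

/-- Inner products in `L²` in terms of representatives. -/
theorem inner_eq_integral {μ : Measure ℂ} {F G : Lp ℂ 2 μ} {f g : ℂ → ℂ} (hf : F =ᵐ[μ] f)
    (hg : G =ᵐ[μ] g) : inner ℂ F G = ∫ z, g z * conj (f z) ∂μ := by
  rw [L2.inner_def]
  refine integral_congr_ae ?_
  filter_upwards [hf, hg] with z h1 h2
  rw [RCLike.inner_apply, h1, h2]

/-- A square integrable function orthogonal to every `dz φ` is holomorphic. -/
theorem exists_memBergman_of_mem_orthogonal {Ω : Set ℂ} (hΩ : IsOpen Ω)
    {F : Lp ℂ 2 (volume.restrict Ω)} (hF : F ∈ (dzRange Ω)ᗮ) :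
    ∃ g, MemBergman Ω g ∧ F =ᵐ[volume.restrict Ω] g := by
  obtain ⟨g, hg, hFg⟩ := exists_differentiableOn_of_weak hΩ (Lp.memLp F) fun ψ hψ => by
    have hs := hψ.star
    have h1 := (Submodule.mem_orthogonal _ _).1 hF ((hs.memLp_dz _).toLp _)
      ⟨_, hs, (hs.memLp_dz _).coeFn_toLp⟩
    rw [inner_eq_integral (hs.memLp_dz _).coeFn_toLp (Filter.EventuallyEq.refl _ _)] at h1
    rw [← h1]
    refine integral_congr_ae (Filter.Eventually.of_forall fun z => ?_)
    simp only [conj_dz (hs.differentiable z), Complex.conj_conj]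
  exact ⟨g, ⟨hg, (memLp_congr_ae hFg).1 (Lp.memLp F)⟩, hFg⟩

/-- If `k` represents the same functional on the Bergman space as `χ`, then `χ - k` is an `L²`
limit of functions `dz φ` with `φ` a test function. -/
theorem exists_eLpNorm_sub_dz_lt {Ω : Set ℂ} (hΩ : IsOpen Ω) {k χ : ℂ → ℂ}
    (hk : MemLp k 2 (volume.restrict Ω)) (hχ : MemLp χ 2 (volume.restrict Ω))
    (hrep : ∀ f, MemBergman Ω f → ∫ z in Ω, f z * conj (k z) = ∫ z in Ω, f z * conj (χ z))
    {ε : ℝ} (hε : 0 < ε) :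
    ∃ φ, IsComplexTest Ω φ ∧
      eLpNorm (fun z => χ z - k z - dz φ z) 2 (volume.restrict Ω) < ENNReal.ofReal ε := by
  set v := (hχ.sub hk).toLp (χ - k) with hv
  have hvae := (hχ.sub hk).coeFn_toLp
  -- The double orthogonal complement is the closure of the range. Functions orthogonal to the range
  -- are holomorphic, and `hrep` says that χ - k annihilates those.
  have hmem : v ∈ (dzRange Ω)ᗮᗮ := by
    rw [Submodule.mem_orthogonal]
    intro F hF
    obtain ⟨g, hg, hFg⟩ := exists_memBergman_of_mem_orthogonal hΩ hF
    rw [← inner_conj_symm, inner_eq_integral hvae hFg]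
    have e : (fun z => g z * conj ((χ - k) z)) =
        fun z => g z * conj (χ z) - g z * conj (k z) := by
      funext z
      simp only [Pi.sub_apply, map_sub]
      ring
    have i1 : Integrable (fun z => g z * conj (χ z)) (volume.restrict Ω) :=
      MemLp.integrable_mul hg.2 hχ.star
    have i2 : Integrable (fun z => g z * conj (k z)) (volume.restrict Ω) :=
      MemLp.integrable_mul hg.2 hk.star
    rw [e, integral_sub i1 i2, hrep g hg, sub_self, map_zero]
  rw [Submodule.orthogonal_orthogonal_eq_closure] at hmem
  obtain ⟨F, ⟨φ, hφ, hF⟩, hd⟩ := Metric.mem_closure_iff.1 hmem ε hε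
  refine ⟨φ, hφ, ?_⟩
  rw [Lp.dist_def] at hd
  have hne : eLpNorm (⇑v - ⇑F) 2 (volume.restrict Ω) ≠ ⊤ :=
    ((Lp.memLp v).sub (Lp.memLp F)).2.ne
  rw [eLpNorm_congr_ae (g := ⇑v - ⇑F), ← ENNReal.ofReal_toReal hne]
  · exact (ENNReal.ofReal_lt_ofReal_iff hε).2 hd
  · filter_upwards [hvae, hF] with z h1 h2
    rw [Pi.sub_apply, hv, h1, h2, Pi.sub_apply]

/-! ### Hardy's inequality for complex test functions -/

theorem hardy_real {Ω : Set ℂ} {t : ℝ} (ht : ENNReal.ofReal t ≤ hardyConstant Ω) {φ : ℂ → ℝ}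
    (hφ : IsTestFunction Ω φ) :
    ENNReal.ofReal t ^ 2 * ∫⁻ z in Ω, ‖φ z‖ₑ ^ 2 / boundaryDist Ω z ^ 2 ≤
      ∫⁻ z in Ω, ‖fderiv ℝ φ z‖ₑ ^ 2 := by
  by_cases h0 : φ = 0
  · simp [h0]
  have h1 : ENNReal.ofReal t ^ 2 ≤ hardyQuotient Ω φ := by
    calc ENNReal.ofReal t ^ 2 ≤ hardyConstant Ω ^ 2 := by gcongr
      _ = ⨅ (φ : ℂ → ℝ) (_ : IsTestFunction Ω φ ∧ φ ≠ 0), hardyQuotient Ω φ := by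
        rw [hardyConstant, ← ENNReal.rpow_natCast, ← ENNReal.rpow_mul]
        norm_num
      _ ≤ _ := iInf₂_le φ ⟨hφ, h0⟩
  exact ENNReal.mul_le_of_le_div h1

/-- The Jacobian of a compactly supported map has integral zero. -/
theorem integral_jacobian_eq_zero {u v : ℂ → ℝ} (hu : ContDiff ℝ ∞ u) (hv : ContDiff ℝ ∞ v)
    (hcu : HasCompactSupport u) :
    Integrable (fun z => fderiv ℝ u z 1 * fderiv ℝ v z Complex.I) ∧
    Integrable (fun z => fderiv ℝ u z Complex.I * fderiv ℝ v z 1) ∧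
    ∫ z, fderiv ℝ u z 1 * fderiv ℝ v z Complex.I =
      ∫ z, fderiv ℝ u z Complex.I * fderiv ℝ v z 1 := by
  have hvd : ∀ w : ℂ, ContDiff ℝ ∞ fun z => fderiv ℝ v z w := fun w =>
    (hv.fderiv_right (m := ∞) (by simp)).clm_apply contDiff_const
  have hvdd : ∀ a b : ℂ, Continuous fun z => fderiv ℝ (fun z => fderiv ℝ v z a) z b := fun a b =>
    ((hvd a).continuous_fderiv (by simp)).clm_apply continuous_const
  have hud : ∀ w : ℂ, Continuous fun z => fderiv ℝ u z w := fun w =>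
    (hu.continuous_fderiv (by simp)).clm_apply continuous_const
  have hcud : ∀ w : ℂ, HasCompactSupport fun z => fderiv ℝ u z w := fun w =>
    hcu.fderiv_apply ℝ w
  have i1 : ∀ a b : ℂ, Integrable fun z => fderiv ℝ u z a * fderiv ℝ v z b := fun a b =>
    ((hud a).mul (hvd b).continuous).integrable_of_hasCompactSupport (hcud a).mul_right
  have i2 : ∀ a b : ℂ, Integrable fun z => u z * fderiv ℝ (fun z => fderiv ℝ v z a) z b :=
    fun a b => (hu.continuous.mul (hvdd a b)).integrable_of_hasCompactSupport hcu.mul_right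
  have i3 : ∀ a : ℂ, Integrable fun z => u z * fderiv ℝ v z a := fun a =>
    (hu.continuous.mul (hvd a).continuous).integrable_of_hasCompactSupport hcu.mul_right
  -- Moving the derivative off u turns both integrals into minus the integral of u times a mixed
  -- second derivative of v, and these are symmetric.
  have ibp : ∀ a b : ℂ, ∫ z, u z * fderiv ℝ (fun z => fderiv ℝ v z a) z b =
      -∫ z, fderiv ℝ u z b * fderiv ℝ v z a := fun a b =>
    integral_mul_fderiv_eq_neg_fderiv_mul_of_integrable (i1 b a) (i2 a b) (i3 a)
      (fun z _ => hu.differentiable (by simp) z) (fun z _ => (hvd a).differentiable (by simp) z)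
  refine ⟨i1 _ _, i1 _ _, ?_⟩
  have h1 := ibp Complex.I 1
  have h2 := ibp 1 Complex.I
  have hsymm : ∀ z, fderiv ℝ (fun z => fderiv ℝ v z Complex.I) z 1 =
      fderiv ℝ (fun z => fderiv ℝ v z 1) z Complex.I := fun z => by
    have hd : DifferentiableAt ℝ (fderiv ℝ v) z :=
      (hv.fderiv_right (m := ∞) (by simp)).differentiable (by simp) z
    have hs : IsSymmSndFDerivAt ℝ v z := hv.contDiffAt.isSymmSndFDerivAt (by
      rw [minSmoothness_of_isRCLikeNormedField]
      exact WithTop.coe_le_coe.2 le_top)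
    rw [fderiv_clm_apply hd (differentiableAt_const _),
      fderiv_clm_apply hd (differentiableAt_const _)]
    simpa using hs 1 Complex.I
  simp_rw [hsymm] at h1
  linarith [h1, h2]

/-- Cauchy-Schwarz; it lets the operator norm in the Hardy quotient be computed from partial
derivatives. -/
theorem norm_clm_sq_le (L : ℂ →L[ℝ] ℝ) : ‖L‖ ^ 2 ≤ L 1 ^ 2 + L Complex.I ^ 2 := by
  have h : ‖L‖ ≤ Real.sqrt (L 1 ^ 2 + L Complex.I ^ 2) := by
    refine L.opNorm_le_bound (Real.sqrt_nonneg _) fun z => ?_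
    have e : L z = z.re * L 1 + z.im * L Complex.I := by
      conv_lhs => rw [← Complex.re_add_im z]
      have h1 : (z.re : ℂ) = z.re • (1 : ℂ) := by simp
      have h2 : (z.im : ℂ) * Complex.I = z.im • Complex.I := by simp
      rw [map_add, h2, h1, map_smul, map_smul, smul_eq_mul, smul_eq_mul]
    rw [Complex.norm_eq_sqrt_sq_add_sq, ← Real.sqrt_mul (by positivity), e]
    refine Real.abs_le_sqrt ?_
    nlinarith [sq_nonneg (z.re * L Complex.I - z.im * L 1)]
  calc ‖L‖ ^ 2 ≤ Real.sqrt (L 1 ^ 2 + L Complex.I ^ 2) ^ 2 := by gcongr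
    _ = _ := Real.sq_sqrt (by positivity)

/-- For the partial derivatives a, b of u + iv the cross term is twice the Jacobian of (u, v), which
integrates to zero. -/
theorem norm_sub_I_mul_sq (a b : ℂ) : ‖a - Complex.I * b‖ ^ 2 =
    a.re ^ 2 + a.im ^ 2 + b.re ^ 2 + b.im ^ 2 + 2 * (a.re * b.im - b.re * a.im) := by
  rw [← Complex.normSq_eq_norm_sq, Complex.normSq_apply]
  simp
  ring

theorem lintegral_enorm_sq_eq {E : Type*} [NormedAddCommGroup E] {p : ℂ → E} {μ : Measure ℂ}
    (hp : Integrable (fun z => ‖p z‖ ^ 2) μ) :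
    ∫⁻ z, ‖p z‖ₑ ^ 2 ∂μ = ENNReal.ofReal (∫ z, ‖p z‖ ^ 2 ∂μ) := by
  rw [ofReal_integral_eq_lintegral_ofReal hp (Filter.Eventually.of_forall fun z => sq_nonneg _)]
  refine lintegral_congr fun z => ?_
  rw [ENNReal.ofReal_pow (norm_nonneg _), ofReal_norm]

theorem integrable_norm_fderiv_sq {p : ℂ → ℝ} (hp : ContDiff ℝ ∞ p) (hc : HasCompactSupport p) :
    Integrable fun z => ‖fderiv ℝ p z‖ ^ 2 := by
  have h1 : Continuous (fderiv ℝ p) := hp.continuous_fderiv (by simp)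
  have h2 : Continuous fun z => ‖fderiv ℝ p z‖ ^ 2 := h1.norm.pow 2
  refine h2.integrable_of_hasCompactSupport (hc.mono' fun z hz => ?_)
  refine support_fderiv_subset ℝ fun h => hz ?_
  simp [h]

/-- The Dirichlet integrals of the real and imaginary parts in terms of `dz`. -/
theorem lintegral_fderiv_re_add_im_le {Ω : Set ℂ} {φ : ℂ → ℂ} (hφ : IsComplexTest Ω φ) :
    (∫⁻ z, ‖fderiv ℝ (fun z => (φ z).re) z‖ₑ ^ 2) +
      ∫⁻ z, ‖fderiv ℝ (fun z => (φ z).im) z‖ₑ ^ 2 ≤ ∫⁻ z, ‖dz φ z‖ₑ ^ 2 := by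
  set u : ℂ → ℝ := fun z => (φ z).re with hu
  set v : ℂ → ℝ := fun z => (φ z).im with hv
  have hus : ContDiff ℝ ∞ u := Complex.reCLM.contDiff.comp hφ.contDiff
  have hvs : ContDiff ℝ ∞ v := Complex.imCLM.contDiff.comp hφ.contDiff
  have huc : HasCompactSupport u := hφ.hasCompactSupport.comp_left Complex.zero_re
  have hvc : HasCompactSupport v := hφ.hasCompactSupport.comp_left Complex.zero_im
  have hud : ∀ z w, fderiv ℝ u z w = (fderiv ℝ φ z w).re := fun z w => by
    have h : HasFDerivAt u (Complex.reCLM.comp (fderiv ℝ φ z)) z :=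
      Complex.reCLM.hasFDerivAt.comp z (hφ.differentiable z).hasFDerivAt
    rw [h.fderiv]
    rfl
  have hvd : ∀ z w, fderiv ℝ v z w = (fderiv ℝ φ z w).im := fun z w => by
    have h : HasFDerivAt v (Complex.imCLM.comp (fderiv ℝ φ z)) z :=
      Complex.imCLM.hasFDerivAt.comp z (hφ.differentiable z).hasFDerivAt
    rw [h.fderiv]
    rfl
  obtain ⟨j1, j2, j3⟩ := integral_jacobian_eq_zero hus hvs huc
  have hdzi : Integrable fun z => ‖dz φ z‖ ^ 2 :=
    (memLp_two_iff_integrable_sq_norm (hφ.memLp_dz volume).1).1 (hφ.memLp_dz volume)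
  have hgu := integrable_norm_fderiv_sq hus huc
  have hgv := integrable_norm_fderiv_sq hvs hvc
  have hji : Integrable fun z => 2 * (fderiv ℝ u z 1 * fderiv ℝ v z Complex.I -
      fderiv ℝ u z Complex.I * fderiv ℝ v z 1) := (j1.sub j2).const_mul 2
  have key : ∫ z, (‖fderiv ℝ u z‖ ^ 2 + ‖fderiv ℝ v z‖ ^ 2) ≤ ∫ z, ‖dz φ z‖ ^ 2 := by
    have h0 : ∫ z, (‖dz φ z‖ ^ 2 - 2 * (fderiv ℝ u z 1 * fderiv ℝ v z Complex.I -
        fderiv ℝ u z Complex.I * fderiv ℝ v z 1)) = ∫ z, ‖dz φ z‖ ^ 2 := by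
      rw [integral_sub hdzi hji, integral_const_mul, integral_sub j1 j2, j3]
      simp
    rw [← h0]
    refine integral_mono (hgu.add hgv)
      (hdzi.sub hji) fun z => ?_
    have h1 := norm_clm_sq_le (fderiv ℝ u z)
    have h2 := norm_clm_sq_le (fderiv ℝ v z)
    simp only [hud, hvd] at h1 h2 ⊢
    have h3 : ‖dz φ z‖ ^ 2 = (fderiv ℝ φ z 1).re ^ 2 + (fderiv ℝ φ z 1).im ^ 2 +
        (fderiv ℝ φ z Complex.I).re ^ 2 + (fderiv ℝ φ z Complex.I).im ^ 2 +
        2 * ((fderiv ℝ φ z 1).re * (fderiv ℝ φ z Complex.I).im -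
          (fderiv ℝ φ z Complex.I).re * (fderiv ℝ φ z 1).im) := norm_sub_I_mul_sq _ _
    linarith
  rw [lintegral_enorm_sq_eq hgu, lintegral_enorm_sq_eq hgv, lintegral_enorm_sq_eq hdzi,
    ← ENNReal.ofReal_add (integral_nonneg fun z => sq_nonneg _)
      (integral_nonneg fun z => sq_nonneg _), ← integral_add hgu hgv]
  exact ENNReal.ofReal_le_ofReal key

/-- Hardy's inequality for complex test functions. -/
theorem hardy_complex {Ω : Set ℂ} {t : ℝ} (ht : ENNReal.ofReal t ≤ hardyConstant Ω) {φ : ℂ → ℂ}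
    (hφ : IsComplexTest Ω φ) :
    ENNReal.ofReal t ^ 2 * ∫⁻ z in Ω, ‖φ z‖ₑ ^ 2 / boundaryDist Ω z ^ 2 ≤
      ∫⁻ z, ‖dz φ z‖ₑ ^ 2 := by
  have hre : IsTestFunction Ω fun z => (φ z).re := by
    refine ⟨Complex.reCLM.contDiff.comp hφ.contDiff,
      hφ.hasCompactSupport.comp_left Complex.zero_re, ?_⟩
    exact (closure_mono (Function.support_comp_subset Complex.zero_re φ)).trans
      hφ.tsupport_subset
  have him : IsTestFunction Ω fun z => (φ z).im := by
    refine ⟨Complex.imCLM.contDiff.comp hφ.contDiff,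
      hφ.hasCompactSupport.comp_left Complex.zero_im, ?_⟩
    exact (closure_mono (Function.support_comp_subset Complex.zero_im φ)).trans
      hφ.tsupport_subset
  have e : ∀ z, ‖φ z‖ₑ ^ 2 / boundaryDist Ω z ^ 2 =
      ‖(φ z).re‖ₑ ^ 2 / boundaryDist Ω z ^ 2 + ‖(φ z).im‖ₑ ^ 2 / boundaryDist Ω z ^ 2 := by
    intro z
    rw [← ENNReal.add_div]
    congr 1
    simp only [← ofReal_norm, ← ENNReal.ofReal_pow (norm_nonneg _)]
    rw [← ENNReal.ofReal_add (by positivity) (by positivity), ← Complex.normSq_eq_norm_sq,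
      Complex.normSq_apply]
    congr 1
    simp only [Real.norm_eq_abs, sq_abs]
    ring
  have hm : Measurable fun z => ‖(φ z).re‖ₑ ^ 2 / boundaryDist Ω z ^ 2 := by
    have h1 : Measurable fun z => (φ z).re := hre.1.continuous.measurable
    have h2 : Measurable (boundaryDist Ω) := measurable_infEDist
    exact (h1.enorm.pow_const 2).div (h2.pow_const 2)
  simp_rw [e]
  rw [lintegral_add_left hm, mul_add]
  refine (add_le_add (hardy_real ht hre) (hardy_real ht him)).trans
    (le_trans ?_ (lintegral_fderiv_re_add_im_le hφ))
  exact add_le_add (setLIntegral_le_lintegral _ _) (setLIntegral_le_lintegral _ _)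

/-! ### The weighted estimate -/

/-- The real part of the left inner product is (‖P‖ - ‖Q‖)(‖P‖ + ‖Q‖), so Cauchy-Schwarz gives ‖P‖ -
‖Q‖ ≤ ‖Y‖. If ‖Q‖ ≤ c‖P‖ with c < 1, then ‖P - Q‖ ≤ (1 + c)/(1 - c) ‖Y‖; here c = 1/3. -/
theorem norm_sub_le_of_inner_eq {H : Type*} [NormedAddCommGroup H] [InnerProductSpace ℂ H]
    {P Q Y : H} (hQ : 3 * ‖Q‖ ≤ ‖P‖) (h : inner ℂ (P + Q) (P - Q) = inner ℂ (P + Q) Y) :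
    ‖P - Q‖ ≤ 2 * ‖Y‖ := by
  have h1 : RCLike.re (inner ℂ (P + Q) (P - Q)) = ‖P‖ ^ 2 - ‖Q‖ ^ 2 := by
    rw [inner_add_left, inner_sub_right, inner_sub_right]
    simp only [map_add, map_sub, inner_self_eq_norm_sq]
    rw [inner_re_symm (𝕜 := ℂ) P Q]
    ring
  have h2 : ‖P‖ ^ 2 - ‖Q‖ ^ 2 ≤ ‖P + Q‖ * ‖Y‖ := by
    rw [← h1, h]
    exact (RCLike.re_le_norm _).trans (norm_inner_le_norm _ _)
  have h3 := norm_add_le P Q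
  have h4 := norm_sub_le P Q
  have hP := norm_nonneg P
  have hQ' := norm_nonneg Q
  have hY := norm_nonneg Y
  have h5 : ‖P + Q‖ * ‖Y‖ ≤ 4 / 3 * ‖P‖ * ‖Y‖ := by gcongr; linarith
  have h6 : ‖Q‖ ^ 2 ≤ (‖P‖ / 3) ^ 2 := by gcongr; linarith
  have h7 : ‖P‖ * ‖P‖ ≤ ‖P‖ * (3 / 2 * ‖Y‖) := by nlinarith
  rcases hP.eq_or_lt with h8 | h8
  · linarith
  · have := le_of_mul_le_mul_left h7 h8
    linarith

theorem setLIntegral_eq_of_support_subset {Ω : Set ℂ} (hΩ : MeasurableSet Ω) {f : ℂ → ℝ≥0∞}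
    (hf : Function.support f ⊆ Ω) : ∫⁻ z in Ω, f z = ∫⁻ z, f z := by
  rw [← lintegral_indicator hΩ, Set.indicator_eq_self.2 hf]

theorem enorm_toLp_sq {μ : Measure ℂ} {f : ℂ → ℂ} (hf : MemLp f 2 μ) :
    ‖hf.toLp f‖ₑ ^ 2 = ∫⁻ z, ‖f z‖ₑ ^ 2 ∂μ := by
  have := eLpNorm_nnreal_pow_eq_lintegral (μ := μ) (f := f) (p := 2) (by norm_num)
  rw [Lp.enorm_toLp]
  norm_num at this
  exact_mod_cast this

/-- For a smooth weight `η` with `|∇η| ≤ τ η / δ`, `3 τ ≤ h(Ω)`, and a holomorphic function `k`,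
the weighted norm of `dz φ` is controlled by the weighted norm of `k + dz φ`. -/
theorem eLpNorm_weight_mul_dz_le {Ω : Set ℂ} (hΩ : IsOpen Ω) {τ M : ℝ}
    (hτ : ENNReal.ofReal (3 * τ) ≤ hardyConstant Ω) {η : ℂ → ℝ} (hη : ContDiff ℝ ∞ η)
    (hM : ∀ z, |η z| ≤ M)
    (hgrad : ∀ z ∈ Ω, ‖dz (fun z => (η z : ℂ)) z‖ₑ ≤
      ENNReal.ofReal τ * ‖η z‖ₑ / boundaryDist Ω z)
    {k φ : ℂ → ℂ} (hk : MemBergman Ω k) (hφ : IsComplexTest Ω φ) :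
    eLpNorm (fun z => η z * dz φ z) 2 (volume.restrict Ω) ≤
      2 * eLpNorm (fun z => η z * (k z + dz φ z)) 2 (volume.restrict Ω) := by
  set μ := volume.restrict Ω with hμ
  have hηc : ContDiff ℝ ∞ fun z => (η z : ℂ) := Complex.ofRealCLM.contDiff.comp hη
  have hηd : Differentiable ℝ fun z => (η z : ℂ) := hηc.differentiable (by simp)
  have hφ' : IsComplexTest Ω fun z => (η z : ℂ) * φ z := hφ.mul_left hηc
  have hψ : IsComplexTest Ω fun z => (η z : ℂ) * ((η z : ℂ) * φ z) := hφ'.mul_left hηc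
  set p : ℂ → ℂ := dz fun z => (η z : ℂ) * φ z with hp
  set q : ℂ → ℂ := fun z => φ z * dz (fun z => (η z : ℂ)) z with hq
  -- p - q is the quantity to be bounded, and η(p + q), being `dz` of η²φ, is orthogonal to k.
  have e1 : ∀ z, η z * dz φ z = p z - q z := fun z => by
    simp only [hp, hq, dz_mul (hηd z) (hφ.differentiable z)]
    ring
  have e2 : ∀ z, dz (fun z => (η z : ℂ) * ((η z : ℂ) * φ z)) z = η z * (p z + q z) := fun z => by
    rw [dz_mul (hηd z) (hφ'.differentiable z)]
    simp only [hp, hq]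
    ring
  have hbdd : ∀ {f : ℂ → ℂ}, MemLp f 2 μ → MemLp (fun z => η z * f z) 2 μ := fun {f} hf => by
    refine MemLp.of_le_mul (c := M) hf
      (hηc.continuous.aestronglyMeasurable.mul hf.1) (Filter.Eventually.of_forall fun z => ?_)
    rw [norm_mul, Complex.norm_real, Real.norm_eq_abs]
    exact mul_le_mul_of_nonneg_right (hM z) (norm_nonneg _)
  have mp : MemLp p 2 μ := hφ'.memLp_dz μ
  have md : MemLp (dz φ) 2 μ := hφ.memLp_dz μ
  have mq : MemLp q 2 μ := by
    have : q = fun z => p z - η z * dz φ z := by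
      funext z
      rw [e1]
      ring
    rw [this]
    exact mp.sub (hbdd md)
  have my : MemLp (fun z => η z * (k z + dz φ z)) 2 μ := hbdd (hk.2.add md)
  have hQP : 3 * ‖mq.toLp q‖ ≤ ‖mp.toLp p‖ := by
    -- Hardy's inequality for ηφ: |q| ≤ τ|ηφ|/δ, while (3τ)²‖ηφ/δ‖² ≤ ‖p‖².
    have h1 : 9 * ∫⁻ z, ‖q z‖ₑ ^ 2 ∂μ ≤ ∫⁻ z, ‖p z‖ₑ ^ 2 ∂μ := by
      rw [hμ, setLIntegral_eq_of_support_subset hΩ.measurableSet (f := fun z => ‖p z‖ₑ ^ 2)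
        (fun z hz => hφ'.tsupport_subset (support_dz_subset _ fun h => hz (by simp [hp, h])))]
      refine le_trans ?_ (hardy_complex hτ hφ')
      rw [← lintegral_const_mul' _ _ (by norm_num), ←
        lintegral_const_mul' _ _ (ENNReal.pow_ne_top ENNReal.ofReal_ne_top)]
      refine setLIntegral_mono' hΩ.measurableSet fun z hz => ?_
      have h2 : ‖q z‖ₑ ≤ ENNReal.ofReal τ * (‖(η z : ℂ) * φ z‖ₑ / boundaryDist Ω z) := by
        simp only [hq, enorm_mul]
        calc ‖φ z‖ₑ * ‖dz (fun z => (η z : ℂ)) z‖ₑ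
            ≤ ‖φ z‖ₑ * (ENNReal.ofReal τ * ‖η z‖ₑ / boundaryDist Ω z) := by
              gcongr
              exact hgrad z hz
          _ = _ := by
              have : ‖(η z : ℂ)‖ₑ = ‖η z‖ₑ := by
                rw [← ofReal_norm, ← ofReal_norm, Complex.norm_real]
              rw [this]
              simp only [div_eq_mul_inv]
              ring
      calc 9 * ‖q z‖ₑ ^ 2
          ≤ 9 * (ENNReal.ofReal τ * (‖(η z : ℂ) * φ z‖ₑ / boundaryDist Ω z)) ^ 2 := by gcongr
        _ = _ := by
            rw [ENNReal.ofReal_mul (by norm_num), mul_pow, mul_pow, ENNReal.ofReal_ofNat]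
            simp only [div_eq_mul_inv, mul_pow, ENNReal.inv_pow]
            ring
    rw [← enorm_toLp_sq mp, ← enorm_toLp_sq mq] at h1
    have h3 := ENNReal.toReal_mono (ENNReal.pow_ne_top enorm_ne_top) h1
    simp only [ENNReal.toReal_mul, ENNReal.toReal_pow, toReal_enorm, ENNReal.toReal_ofNat] at h3
    nlinarith [norm_nonneg (mq.toLp q), norm_nonneg (mp.toLp p)]
  have hk0 : ∫ z, k z * conj (η z * (p z + q z)) ∂μ = 0 := by
    rw [← integral_mul_dbar_eq_zero hΩ hk.1 hψ.star, hμ]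
    have e3 : ∀ z, conj (η z * (p z + q z)) =
        dbar (fun z => conj ((η z : ℂ) * ((η z : ℂ) * φ z))) z := fun z => by
      rw [← e2, conj_dz (hψ.differentiable z)]
    simp_rw [e3]
    refine setIntegral_eq_integral_of_forall_compl_eq_zero fun z hz => ?_
    rw [Function.notMem_support.1 fun h => hz (hψ.star.tsupport_subset (support_dbar_subset _ h)),
      mul_zero]
  have mpq : MemLp (fun z => p z + q z) 2 μ := mp.add mq
  have c1 : ⇑(mp.toLp p + mq.toLp q) =ᵐ[μ] fun z => p z + q z := by
    filter_upwards [Lp.coeFn_add (mp.toLp p) (mq.toLp q), mp.coeFn_toLp, mq.coeFn_toLp]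
      with z h1 h2 h3
    rw [h1, Pi.add_apply, h2, h3]
  have c2 : ⇑(mp.toLp p - mq.toLp q) =ᵐ[μ] fun z => η z * dz φ z := by
    filter_upwards [Lp.coeFn_sub (mp.toLp p) (mq.toLp q), mp.coeFn_toLp, mq.coeFn_toLp]
      with z h1 h2 h3
    rw [h1, Pi.sub_apply, h2, h3, e1]
  have hin : inner ℂ (mp.toLp p + mq.toLp q) (mp.toLp p - mq.toLp q) =
      inner ℂ (mp.toLp p + mq.toLp q) (my.toLp _) := by
    rw [inner_eq_integral c1 c2, inner_eq_integral c1 my.coeFn_toLp]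
    have i1 : Integrable (fun z => k z * conj (η z * (p z + q z))) μ :=
      MemLp.integrable_mul hk.2 (hbdd mpq).star
    have i2 : Integrable (fun z => η z * dz φ z * conj (p z + q z)) μ :=
      MemLp.integrable_mul (hbdd md) mpq.star
    -- Adding the vanishing pairing with k replaces η `dz φ` by η(k + `dz φ`).
    rw [← zero_add (∫ z, η z * dz φ z * conj (p z + q z) ∂μ), ← hk0, ← integral_add i1 i2]
    refine integral_congr_ae (Filter.Eventually.of_forall fun z => ?_)
    simp only [map_mul, Complex.conj_ofReal]
    ring
  have hfin := norm_sub_le_of_inner_eq hQP hin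
  have hfin' : ‖mp.toLp p - mq.toLp q‖ₑ ≤ 2 * ‖my.toLp _‖ₑ := by
    have := ENNReal.ofReal_le_ofReal hfin
    rwa [ENNReal.ofReal_mul (by norm_num), ofReal_norm, ofReal_norm, ENNReal.ofReal_ofNat] at this
  rwa [Lp.enorm_def, eLpNorm_congr_ae c2, Lp.enorm_toLp] at hfin'

/-- The weighted estimate for the solution `χ - k` of the Dirichlet problem. -/
theorem eLpNorm_weight_mul_le {Ω : Set ℂ} (hΩ : IsOpen Ω) {τ M : ℝ}
    (hτ : ENNReal.ofReal (3 * τ) ≤ hardyConstant Ω) {η : ℂ → ℝ} (hη : ContDiff ℝ ∞ η)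
    (hM : ∀ z, |η z| ≤ M)
    (hgrad : ∀ z ∈ Ω, ‖dz (fun z => (η z : ℂ)) z‖ₑ ≤
      ENNReal.ofReal τ * ‖η z‖ₑ / boundaryDist Ω z)
    {k χ : ℂ → ℂ} (hk : MemBergman Ω k) (hχ : MemLp χ 2 (volume.restrict Ω))
    (hrep : ∀ f, MemBergman Ω f → ∫ z in Ω, f z * conj (k z) = ∫ z in Ω, f z * conj (χ z)) :
    eLpNorm (fun z => η z * k z) 2 (volume.restrict Ω) ≤
      3 * eLpNorm (fun z => η z * χ z) 2 (volume.restrict Ω) := by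
  set μ := volume.restrict Ω with hμ
  have hηm : AEStronglyMeasurable (fun z => (η z : ℂ)) μ :=
    (Complex.continuous_ofReal.comp hη.continuous).aestronglyMeasurable
  have hM0 : 0 ≤ M := (abs_nonneg _).trans (hM 0)
  refine ENNReal.le_of_forall_pos_le_add fun ε hε _ => ?_
  -- The bound M enters only this tolerance, which makes 3‖ηE‖ ≤ ε, so the final estimate is
  -- independent of sup η. Using M + 1 covers M = 0.
  obtain ⟨φ, hφ, hlt⟩ := exists_eLpNorm_sub_dz_lt hΩ hk.2 hχ hrep
    (ε := ε / (3 * (M + 1))) (by positivity)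
  have md : MemLp (dz φ) 2 μ := hφ.memLp_dz μ
  set E : ℂ → ℂ := fun z => χ z - k z - dz φ z with hE
  have mE : MemLp E 2 μ := (hχ.sub hk.2).sub md
  have hηE : 3 * eLpNorm (fun z => η z * E z) 2 μ ≤ ε := by
    have h1 : eLpNorm (fun z => η z * E z) 2 μ ≤ ENNReal.ofReal M * eLpNorm E 2 μ := by
      refine eLpNorm_le_mul_eLpNorm_of_ae_le_mul (Filter.Eventually.of_forall fun z => ?_) 2
      rw [norm_mul, Complex.norm_real, Real.norm_eq_abs]
      exact mul_le_mul_of_nonneg_right (hM z) (norm_nonneg _)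
    calc 3 * eLpNorm (fun z => η z * E z) 2 μ
        ≤ 3 * (ENNReal.ofReal M * ENNReal.ofReal (ε / (3 * (M + 1)))) := by
          gcongr
          exact h1.trans (by gcongr)
      _ = ENNReal.ofReal (3 * (M * (ε / (3 * (M + 1))))) := by
          rw [ENNReal.ofReal_mul (by norm_num), ENNReal.ofReal_mul hM0, ENNReal.ofReal_ofNat]
      _ ≤ ENNReal.ofReal ε := by
          refine ENNReal.ofReal_le_ofReal ?_
          rw [show 3 * (M * (ε / (3 * (M + 1)))) = ε * (M / (M + 1)) by field_simp]
          exact mul_le_of_le_one_right ε.2 ((div_le_one (by positivity)).2 (by linarith))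
      _ = ε := ENNReal.ofReal_coe_nnreal
  have m1 : AEStronglyMeasurable (fun z => η z * χ z) μ := hηm.mul hχ.1
  have m2 : AEStronglyMeasurable (fun z => η z * E z) μ := hηm.mul mE.1
  have m3 : AEStronglyMeasurable (fun z => η z * dz φ z) μ := hηm.mul md.1
  have h1 := eLpNorm_weight_mul_dz_le hΩ hτ hη hM hgrad hk hφ
  have e1 : (fun z => η z * (k z + dz φ z)) = (fun z => η z * χ z) - fun z => η z * E z := by
    funext z
    simp only [Pi.sub_apply, hE]
    ring
  have e2 : (fun z => η z * k z) =
      ((fun z => η z * χ z) - fun z => η z * E z) - fun z => η z * dz φ z := by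
    funext z
    simp only [Pi.sub_apply, hE]
    ring
  have h2 := eLpNorm_sub_le m1 m2 (p := 2) (by norm_num)
  rw [e1] at h1
  calc eLpNorm (fun z => η z * k z) 2 μ
      ≤ eLpNorm ((fun z => η z * χ z) - fun z => η z * E z) 2 μ +
          eLpNorm (fun z => η z * dz φ z) 2 μ := by
        rw [e2]
        exact eLpNorm_sub_le (m1.sub m2) m3 (by norm_num)
    _ ≤ eLpNorm ((fun z => η z * χ z) - fun z => η z * E z) 2 μ +
          2 * eLpNorm ((fun z => η z * χ z) - fun z => η z * E z) 2 μ := by gcongr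
    _ = 3 * eLpNorm ((fun z => η z * χ z) - fun z => η z * E z) 2 μ := by ring
    _ ≤ 3 * (eLpNorm (fun z => η z * χ z) 2 μ + eLpNorm (fun z => η z * E z) 2 μ) := by gcongr
    _ ≤ _ := by
        rw [mul_add]
        gcongr

/-! ### Smooth weights comparable to negative powers of the boundary distance -/

theorem dz_comp_real {g : ℂ → ℝ} {F : ℝ → ℝ} {z : ℂ} {c : ℝ} (hg : DifferentiableAt ℝ g z)
    (hF : HasDerivAt F c (g z)) :
    dz (fun z => (F (g z) : ℂ)) z = c * dz (fun z => (g z : ℂ)) z := by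
  have h1 := Complex.ofRealCLM.hasFDerivAt.comp z hg.hasFDerivAt
  have h2 := Complex.ofRealCLM.hasFDerivAt.comp z (hF.hasFDerivAt.comp z hg.hasFDerivAt)
  have e1 : fderiv ℝ (fun z => (g z : ℂ)) z = _ := h1.fderiv
  have e2 : fderiv ℝ (fun z => (F (g z) : ℂ)) z = _ := h2.fderiv
  simp only [dz, e1, e2]
  simp
  ring

theorem dz_sum_real {ι : Type*} (s : Finset ι) {g : ι → ℂ → ℝ} {z : ℂ}
    (hg : ∀ i ∈ s, DifferentiableAt ℝ (g i) z) :
    dz (fun z => ((∑ i ∈ s, g i z : ℝ) : ℂ)) z = ∑ i ∈ s, dz (fun z => (g i z : ℂ)) z := by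
  have h : ∀ i ∈ s, DifferentiableAt ℝ (fun z => (g i z : ℂ)) z := fun i hi =>
    Complex.ofRealCLM.differentiableAt.comp z (hg i hi)
  simp only [dz, Complex.ofReal_sum]
  rw [fderiv_fun_sum h, Finset.sum_sub_distrib, ← Finset.mul_sum]
  simp

theorem dz_norm_sub_sq_add (a z : ℂ) (ε : ℝ) :
    dz (fun z => ((‖z - a‖ ^ 2 + ε : ℝ) : ℂ)) z = 2 * conj (z - a) := by
  have h1 : HasFDerivAt (fun z : ℂ => ‖z - a‖ ^ 2 + ε) (2 • (innerSL ℝ (z - a))) z := by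
    have := ((hasFDerivAt_id (𝕜 := ℝ) z).sub_const a).norm_sq.add_const ε
    simpa using this
  have h2 := Complex.ofRealCLM.hasFDerivAt.comp z h1
  have e2 : fderiv ℝ (fun z => ((‖z - a‖ ^ 2 + ε : ℝ) : ℂ)) z = _ := h2.fderiv
  simp only [dz, e2]
  apply Complex.ext
  · simp [Complex.inner]
  · simp [Complex.inner]
    ring

/-- The weight `(∑ (|z - a_j|² + ε)⁻ᴺ) ^ (τ / 2N)`, a smooth version of
`max_j |z - a_j| ^ (-τ)`. -/
def poleWeight {ι : Type*} (s : Finset ι) (a : ι → ℂ) (ε : ℝ) (N : ℕ) (τ : ℝ) (z : ℂ) : ℝ :=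
  (∑ j ∈ s, ((‖z - a j‖ ^ 2 + ε) ^ N)⁻¹) ^ (τ / (2 * N))

section poleWeight

variable {ι : Type*} {s : Finset ι} {a : ι → ℂ} {ε : ℝ} {N : ℕ} {τ : ℝ}

theorem poleWeight_sum_pos (hs : s.Nonempty) (hε : 0 < ε) (z : ℂ) :
    0 < ∑ j ∈ s, ((‖z - a j‖ ^ 2 + ε) ^ N)⁻¹ :=
  Finset.sum_pos (fun j _ => by positivity) hs

theorem poleWeight_pos (hs : s.Nonempty) (hε : 0 < ε) (z : ℂ) : 0 < poleWeight s a ε N τ z :=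
  Real.rpow_pos_of_pos (poleWeight_sum_pos hs hε z) _

theorem contDiff_norm_sub_sq_add (b : ℂ) (ε : ℝ) : ContDiff ℝ ∞ fun z : ℂ => ‖z - b‖ ^ 2 + ε :=
  ((contDiff_id.sub contDiff_const).norm_sq ℝ).add contDiff_const

theorem contDiff_poleWeight_term (hε : 0 < ε) (b : ℂ) :
    ContDiff ℝ ∞ fun z : ℂ => ((‖z - b‖ ^ 2 + ε) ^ N)⁻¹ :=
  ((contDiff_norm_sub_sq_add b ε).pow N).inv fun z => by positivity

theorem contDiff_poleWeight (hs : s.Nonempty) (hε : 0 < ε) :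
    ContDiff ℝ ∞ (poleWeight s a ε N τ) :=
  (ContDiff.sum fun j _ => contDiff_poleWeight_term hε (a j)).rpow_const_of_ne
    fun z => (poleWeight_sum_pos hs hε z).ne'

theorem poleWeight_le (hε : 0 < ε) (hτ : 0 ≤ τ) (z : ℂ) :
    poleWeight s a ε N τ z ≤ (∑ _j ∈ s, (ε ^ N)⁻¹) ^ (τ / (2 * N)) := by
  refine Real.rpow_le_rpow (Finset.sum_nonneg fun j _ => by positivity)
    (Finset.sum_le_sum fun j _ => ?_) (by positivity)
  gcongr
  linarith [sq_nonneg ‖z - a j‖]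

/-- The sum has at most N ≤ 2^N terms, and the exponent τ/(2N) shrinks that count to at most
2^(τ/2). Hence N must grow with the number of poles. -/
theorem poleWeight_le_two_mul {z : ℂ} {d : ℝ} (hd : 0 < d) (hda : ∀ j ∈ s, d ≤ ‖z - a j‖)
    (hN : 0 < N) (hcard : s.card ≤ N) (hε : 0 < ε) (hτ : 0 ≤ τ) (hτ1 : τ ≤ 1) :
    poleWeight s a ε N τ z ≤ 2 * d ^ (-τ) := by
  have hN' : (0 : ℝ) < N := by exact_mod_cast hN
  have h1 : ∑ j ∈ s, ((‖z - a j‖ ^ 2 + ε) ^ N)⁻¹ ≤ 2 ^ N * (d ^ (2 * N))⁻¹ := by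
    calc ∑ j ∈ s, ((‖z - a j‖ ^ 2 + ε) ^ N)⁻¹ ≤ ∑ j ∈ s, (d ^ (2 * N))⁻¹ := by
          refine Finset.sum_le_sum fun j hj => ?_
          rw [pow_mul]
          gcongr
          have := pow_le_pow_left₀ hd.le (hda j hj) 2
          linarith
      _ = s.card * (d ^ (2 * N))⁻¹ := by simp
      _ ≤ 2 ^ N * (d ^ (2 * N))⁻¹ := by
          gcongr
          exact_mod_cast hcard.trans N.lt_two_pow_self.le
  calc poleWeight s a ε N τ z ≤ (2 ^ N * (d ^ (2 * N))⁻¹) ^ (τ / (2 * N)) :=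
        Real.rpow_le_rpow (Finset.sum_nonneg fun j _ => by positivity) h1 (by positivity)
    _ = 2 ^ (τ / 2) * d ^ (-τ) := by
        rw [Real.mul_rpow (by positivity) (by positivity), ← Real.rpow_natCast 2 N,
          ← Real.rpow_mul (by norm_num), ← Real.rpow_natCast d, ← Real.rpow_neg hd.le,
          ← Real.rpow_mul hd.le]
        congr 2
        · field_simp
        · push_cast
          field_simp
    _ ≤ 2 * d ^ (-τ) := by
        gcongr
        calc (2 : ℝ) ^ (τ / 2) ≤ 2 ^ (1 : ℝ) :=
              Real.rpow_le_rpow_of_exponent_le (by norm_num) (by linarith)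
          _ = 2 := Real.rpow_one 2

/-- One term of the sum suffices; as ε → 0 it recovers the power -τ of the distance to that pole. -/
theorem le_poleWeight {z : ℂ} {j : ι} (hj : j ∈ s) (hN : 0 < N) (hε : 0 < ε) (hτ : 0 ≤ τ) :
    (‖z - a j‖ ^ 2 + ε) ^ (-τ / 2) ≤ poleWeight s a ε N τ z := by
  have hN' : (0 : ℝ) < N := by exact_mod_cast hN
  have hpos : 0 < ‖z - a j‖ ^ 2 + ε := by positivity
  have h1 : ((‖z - a j‖ ^ 2 + ε) ^ N)⁻¹ ≤ ∑ j ∈ s, ((‖z - a j‖ ^ 2 + ε) ^ N)⁻¹ :=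
    Finset.single_le_sum (f := fun j => ((‖z - a j‖ ^ 2 + ε) ^ N)⁻¹)
      (fun j _ => by positivity) hj
  refine le_trans (le_of_eq ?_) (Real.rpow_le_rpow (by positivity) h1 (by positivity))
  rw [← Real.rpow_natCast (‖z - a j‖ ^ 2 + ε) N, ← Real.rpow_neg hpos.le, ← Real.rpow_mul hpos.le]
  congr 1
  field_simp

/-- The logarithmic gradient of the weight is at most `τ / d`. -/
theorem norm_dz_poleWeight_mul_le {z : ℂ} {d : ℝ} (hd : 0 < d)
    (hda : ∀ j ∈ s, d ≤ ‖z - a j‖) (hs : s.Nonempty) (hN : 0 < N) (hε : 0 < ε) (hτ : 0 ≤ τ) :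
    ‖dz (fun z => (poleWeight s a ε N τ z : ℂ)) z‖ * d ≤ τ * poleWeight s a ε N τ z := by
  have hN' : (0 : ℝ) < N := by exact_mod_cast hN
  set S : ℂ → ℝ := fun z => ∑ j ∈ s, ((‖z - a j‖ ^ 2 + ε) ^ N)⁻¹ with hS
  have hSpos : 0 < S z := poleWeight_sum_pos hs hε z
  -- Each term x^(-N) has logarithmic gradient 2N‖z - a j‖/x ≤ 2N/d, and so does the sum; the outer
  -- exponent τ/(2N) makes it τ/d, whatever N and ε.
  have hterm : ∀ j ∈ s, ‖dz (fun z => (((‖z - a j‖ ^ 2 + ε) ^ N)⁻¹ : ℝ)) z‖ * d ≤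
      2 * N * ((‖z - a j‖ ^ 2 + ε) ^ N)⁻¹ := by
    intro j hj
    set x := ‖z - a j‖ ^ 2 + ε with hx
    have hxpos : 0 < x := by positivity
    have hF : HasDerivAt (fun y : ℝ => (y ^ N)⁻¹) (-(N * x ^ (N - 1)) / (x ^ N) ^ 2) x :=
      (hasDerivAt_pow N x).fun_inv (by positivity)
    have hg : DifferentiableAt ℝ (fun z : ℂ => ‖z - a j‖ ^ 2 + ε) z :=
      (contDiff_norm_sub_sq_add (a j) ε).differentiable (by simp) z
    rw [dz_comp_real hg hF, dz_norm_sub_sq_add, norm_mul, norm_mul, Complex.norm_real,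
      Complex.norm_conj, Complex.norm_two, norm_div, norm_neg, Real.norm_of_nonneg (by positivity),
      Real.norm_of_nonneg (by positivity)]
    have h1 : ‖z - a j‖ * d ≤ x := by
      nlinarith [hda j hj, norm_nonneg (z - a j)]
    have h2 : N * x ^ (N - 1) / (x ^ N) ^ 2 * x = N * (x ^ N)⁻¹ := by
      obtain ⟨m, rfl⟩ : ∃ m, N = m + 1 := ⟨N - 1, by omega⟩
      simp only [Nat.add_sub_cancel]
      field_simp
      ring
    calc N * x ^ (N - 1) / (x ^ N) ^ 2 * (2 * ‖z - a j‖) * d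
        = 2 * (N * x ^ (N - 1) / (x ^ N) ^ 2) * (‖z - a j‖ * d) := by ring
      _ ≤ 2 * (N * x ^ (N - 1) / (x ^ N) ^ 2) * x := by gcongr
      _ = _ := by rw [mul_assoc, h2]; ring
  have hsum : ‖dz (fun z => (S z : ℂ)) z‖ * d ≤ 2 * N * S z := by
    rw [hS, dz_sum_real s fun j _ =>
      (contDiff_poleWeight_term hε (a j)).differentiable (by simp) z, Finset.mul_sum]
    calc _ ≤ (∑ j ∈ s, ‖dz (fun z => (((‖z - a j‖ ^ 2 + ε) ^ N)⁻¹ : ℝ)) z‖) * d := by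
          gcongr
          exact norm_sum_le _ _
      _ ≤ _ := by
          rw [Finset.sum_mul]
          exact Finset.sum_le_sum hterm
  have hSd : DifferentiableAt ℝ S z :=
    (ContDiff.sum fun j _ => contDiff_poleWeight_term hε (a j)).differentiable
      (n := ∞) (by simp) z
  have hF := Real.hasDerivAt_rpow_const (x := S z) (p := τ / (2 * N)) (Or.inl hSpos.ne')
  change ‖dz (fun z => ((S z ^ (τ / (2 * N)) : ℝ) : ℂ)) z‖ * d ≤ τ * S z ^ (τ / (2 * N))
  rw [dz_comp_real hSd hF, norm_mul, Complex.norm_real, Real.norm_of_nonneg (by positivity)]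
  calc τ / (2 * N) * S z ^ (τ / (2 * N) - 1) * ‖dz (fun z => (S z : ℂ)) z‖ * d
      = τ / (2 * N) * S z ^ (τ / (2 * N) - 1) * (‖dz (fun z => (S z : ℂ)) z‖ * d) := by ring
    _ ≤ τ / (2 * N) * S z ^ (τ / (2 * N) - 1) * (2 * N * S z) := by gcongr
    _ = τ * S z ^ (τ / (2 * N)) := by
        rw [Real.rpow_sub_one hSpos.ne']
        field_simp

end poleWeight

/-! ### Approximating a negative power of the boundary distance -/

theorem infDist_frontier_pos {Ω : Set ℂ} (hΩ : IsOpen Ω) (hF : (frontier Ω).Nonempty) {z : ℂ}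
    (hz : z ∈ Ω) : 0 < infDist z (frontier Ω) :=
  (isClosed_frontier.notMem_iff_infDist_pos hF).1 fun h =>
    (hΩ.frontier_eq ▸ h).2 hz

theorem boundaryDist_eq_ofReal {Ω : Set ℂ} (hF : (frontier Ω).Nonempty) (z : ℂ) :
    boundaryDist Ω z = ENNReal.ofReal (infDist z (frontier Ω)) :=
  (ENNReal.ofReal_toReal (infEDist_ne_top hF)).symm

/-- Bounded smooth weights `η n`, with logarithmic gradient at most `τ / δ`, that are bounded by
`2 δ ^ (-τ)` and whose lower limit is at least `δ ^ (-τ)`. -/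
theorem exists_weights {Ω : Set ℂ} (hΩ : IsOpen Ω) (hF : (frontier Ω).Nonempty) {τ : ℝ}
    (hτ : 0 ≤ τ) (hτ1 : τ ≤ 1) :
    ∃ η : ℕ → ℂ → ℝ, (∀ n, ContDiff ℝ ∞ (η n)) ∧ (∀ n, ∃ M, ∀ z, |η n z| ≤ M) ∧
      (∀ n, ∀ z ∈ Ω, ‖dz (fun z => (η n z : ℂ)) z‖ₑ ≤
        ENNReal.ofReal τ * ‖η n z‖ₑ / boundaryDist Ω z) ∧
      (∀ n, ∀ z ∈ Ω, |η n z| ≤ 2 * infDist z (frontier Ω) ^ (-τ)) ∧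
      ∀ z ∈ Ω, ∀ c < infDist z (frontier Ω) ^ (-τ), ∀ᶠ n in Filter.atTop, c ≤ |η n z| := by
  have : Nonempty (frontier Ω) := hF.to_subtype
  -- The poles are dense in the boundary: none is nearer than δ, and some come arbitrarily close to
  -- that distance.
  obtain ⟨a, ha⟩ := TopologicalSpace.exists_dense_seq (frontier Ω)
  have hda : ∀ z, ∀ j, infDist z (frontier Ω) ≤ ‖z - a j‖ := fun z j => by
    rw [← dist_eq_norm]
    exact infDist_le_dist_of_mem (a j).2
  have hε : ∀ n : ℕ, 0 < 1 / ((n : ℝ) + 1) := fun n => by positivity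
  have hs : ∀ n : ℕ, (Finset.range (n + 1)).Nonempty := fun n => ⟨0, by simp⟩
  set η : ℕ → ℂ → ℝ := fun n =>
    poleWeight (Finset.range (n + 1)) (fun j => (a j : ℂ)) (1 / ((n : ℝ) + 1)) (n + 1) τ with hη
  have hpos : ∀ n z, 0 < η n z := fun n z => poleWeight_pos (hs n) (hε n) z
  have habs : ∀ n z, |η n z| = η n z := fun n z => abs_of_pos (hpos n z)
  refine ⟨η, fun n => contDiff_poleWeight (hs n) (hε n), fun n => ?_, fun n z hz => ?_,
    fun n z hz => ?_, fun z hz c hc => ?_⟩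
  · exact ⟨_, fun z => (habs n z).trans_le (poleWeight_le (hε n) hτ z)⟩
  · have hd := infDist_frontier_pos hΩ hF hz
    have h := norm_dz_poleWeight_mul_le (τ := τ) hd (fun j _ => hda z j) (hs n) n.succ_pos (hε n) hτ
    rw [boundaryDist_eq_ofReal hF, ENNReal.le_div_iff_mul_le
      (Or.inl (by simpa using hd)) (Or.inl ENNReal.ofReal_ne_top), ← ofReal_norm,
      ← ENNReal.ofReal_mul (norm_nonneg _), ← ofReal_norm, ← ENNReal.ofReal_mul hτ,
      Real.norm_eq_abs, habs]
    exact ENNReal.ofReal_le_ofReal h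
  · rw [habs]
    exact poleWeight_le_two_mul (infDist_frontier_pos hΩ hF hz) (fun j _ => hda z j)
      n.succ_pos (by simp) (hε n) hτ hτ1
  · have hd := infDist_frontier_pos hΩ hF hz
    -- By continuity and density some pole a j still has ‖z - a j‖^(-τ) > c. It contributes to every
    -- weight with n ≥ j, and the regularization tends to zero.
    have hcont : Filter.Tendsto (fun x : ℝ => x ^ (-τ)) (nhds (infDist z (frontier Ω)))
        (nhds (infDist z (frontier Ω) ^ (-τ))) :=
      (Real.continuousAt_rpow_const _ _ (Or.inl hd.ne')).tendsto
    obtain ⟨δ, hδ, hδc⟩ := Metric.eventually_nhds_iff.1 (hcont.eventually (lt_mem_nhds hc))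
    obtain ⟨b, hb, hbd⟩ := (infDist_lt_iff hF).1 (lt_add_of_pos_right
      (infDist z (frontier Ω)) hδ)
    obtain ⟨j, hj⟩ := ha.exists_mem_open
      (isOpen_lt (continuous_const.dist continuous_subtype_val) continuous_const :
        IsOpen {x : frontier Ω | dist z (x : ℂ) < infDist z (frontier Ω) + δ}) ⟨⟨b, hb⟩, hbd⟩
    have hjd : dist z (a j : ℂ) < infDist z (frontier Ω) + δ := hj
    have hjn := hda z j
    have hjpos : 0 < ‖z - a j‖ := hd.trans_le hjn
    have hcj : c < ‖z - a j‖ ^ (-τ) := by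
      refine hδc ?_
      rw [dist_eq_norm] at hjd
      rw [Real.dist_eq, abs_of_nonneg (by linarith)]
      linarith
    have hlim : Filter.Tendsto (fun n : ℕ => (‖z - a j‖ ^ 2 + 1 / ((n : ℝ) + 1)) ^ (-τ / 2))
        Filter.atTop (nhds ((‖z - a j‖ ^ 2 + 0) ^ (-τ / 2))) :=
      (tendsto_const_nhds.add tendsto_one_div_add_atTop_nhds_zero_nat).rpow_const
        (Or.inl (by positivity))
    have e : (‖z - a j‖ ^ 2 + 0) ^ (-τ / 2) = ‖z - a j‖ ^ (-τ) := by
      rw [add_zero, ← Real.rpow_natCast, ← Real.rpow_mul hjpos.le]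
      congr 1
      push_cast
      ring
    rw [e] at hlim
    filter_upwards [hlim.eventually (lt_mem_nhds hcj), Filter.eventually_ge_atTop j] with n h1 h2
    rw [habs]
    exact h1.le.trans (le_poleWeight (a := fun j => (a j : ℂ)) (Finset.mem_range.2 (by omega))
      n.succ_pos (hε n) hτ)

/-! ### Integrability of the Bergman kernel -/

theorem lintegral_enorm_sq_eq_eLpNorm_sq {μ : Measure ℂ} (f : ℂ → ℂ) :
    ∫⁻ z, ‖f z‖ₑ ^ 2 ∂μ = eLpNorm f 2 μ ^ 2 := by
  have := eLpNorm_nnreal_pow_eq_lintegral (μ := μ) (f := f) (p := 2) (by norm_num)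
  norm_num at this
  exact_mod_cast this.symm

/-- Evaluation at `w` is represented by a function supported in a small disc about `w`. -/
theorem exists_local_representative {Ω : Set ℂ} {w : ℂ} {r : ℝ} (hr : 0 < r)
    (hrΩ : ball w r ⊆ Ω) :
    ∃ χ : ℂ → ℂ, MemLp χ 2 (volume.restrict Ω) ∧ (∀ z ∉ ball w r, χ z = 0) ∧
      ∀ f, MemBergman Ω f → f w = ∫ z in Ω, f z * conj (χ z) := by
  obtain ⟨κ, hκ, hrep⟩ := exists_isReproducingAt (isOpen_ball (x := w) (ε := r))
    (mem_ball_self hr)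
  refine ⟨(ball w r).indicator κ, ?_, fun z hz => Set.indicator_of_notMem hz κ, fun f hf => ?_⟩
  · exact ((memLp_indicator_iff_restrict measurableSet_ball).2 hκ.2).restrict Ω
  · rw [hrep f ⟨hf.1.mono hrΩ, hf.2.mono_measure (Measure.restrict_mono hrΩ le_rfl)⟩]
    have e : (fun z => f z * conj ((ball w r).indicator κ z)) =
        (ball w r).indicator fun z => f z * conj (κ z) := by
      funext z
      by_cases hz : z ∈ ball w r <;> simp [hz]
    rw [e, integral_indicator measurableSet_ball, Measure.restrict_restrict measurableSet_ball,
      Set.inter_eq_left.2 hrΩ]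

/-- Weighted square integrability of the Bergman kernel. -/
theorem lintegral_rpow_mul_enorm_sq_lt_top {Ω : Set ℂ} (hΩ : IsOpen Ω)
    (hF : (frontier Ω).Nonempty) {τ : ℝ} (hτ : 0 ≤ τ) (hτ1 : τ ≤ 1)
    (hh : ENNReal.ofReal (3 * τ) ≤ hardyConstant Ω) {w : ℂ} (hw : w ∈ Ω) {k : ℂ → ℂ}
    (hk : IsReproducingAt Ω w k) :
    ∫⁻ z in Ω, (ENNReal.ofReal (infDist z (frontier Ω) ^ (-τ)) * ‖k z‖ₑ) ^ 2 < ⊤ := by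
  set μ := volume.restrict Ω with hμ
  set d : ℂ → ℝ := fun z => infDist z (frontier Ω) with hd
  have hdpos : ∀ z ∈ Ω, 0 < d z := fun z hz => infDist_frontier_pos hΩ hF hz
  obtain ⟨R, hR, hRΩ⟩ := Metric.isOpen_iff.1 hΩ w hw
  have hdw := hdpos w hw
  -- On this disc δ ≥ δ(w)/2, so all the weights are bounded by C on the support of χ.
  set r := min R (d w / 2) with hr
  have hrpos : 0 < r := lt_min hR (by positivity)
  obtain ⟨χ, hχ, hχ0, hχrep⟩ := exists_local_representative hrpos
    ((ball_subset_ball (min_le_left _ _)).trans hRΩ)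
  have hrep : ∀ f, MemBergman Ω f →
      ∫ z in Ω, f z * conj (k z) = ∫ z in Ω, f z * conj (χ z) := fun f hf => by
    rw [← hk.2 f hf, hχrep f hf]
  obtain ⟨η, hsm, hbd, hgrad, hup, hlow⟩ := exists_weights hΩ hF hτ hτ1
  set C : ℝ := 2 * (d w / 2) ^ (-τ) with hC
  have hηχ : ∀ n, eLpNorm (fun z => η n z * χ z) 2 μ ≤ ENNReal.ofReal C * eLpNorm χ 2 μ := by
    intro n
    refine eLpNorm_le_mul_eLpNorm_of_ae_le_mul
      (ae_restrict_of_forall_mem hΩ.measurableSet fun z hz => ?_) 2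
    rw [norm_mul, Complex.norm_real, Real.norm_eq_abs]
    by_cases hzb : z ∈ ball w r
    · refine mul_le_mul_of_nonneg_right ((hup n z hz).trans ?_) (norm_nonneg _)
      have h1 : d w ≤ d z + dist w z := infDist_le_infDist_add_dist
      have h2 : dist w z < d w / 2 := by
        rw [dist_comm]
        exact (mem_ball.1 hzb).trans_le (min_le_right _ _)
      rw [hC]
      gcongr 2 * ?_
      exact Real.rpow_le_rpow_of_nonpos (by positivity) (by linarith) (by linarith)
    · simp [hχ0 z hzb]
  set B : ℝ≥0∞ := (3 * (ENNReal.ofReal C * eLpNorm χ 2 μ)) ^ 2 with hB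
  have hBtop : B < ⊤ := by
    refine ENNReal.pow_lt_top (ENNReal.mul_lt_top (by norm_num) ?_)
    exact ENNReal.mul_lt_top ENNReal.ofReal_lt_top hχ.2
  have hn : ∀ n, ∫⁻ z, ‖η n z * k z‖ₑ ^ 2 ∂μ ≤ B := fun n => by
    obtain ⟨M, hM⟩ := hbd n
    rw [lintegral_enorm_sq_eq_eLpNorm_sq]
    refine pow_le_pow_left₀ (zero_le) ?_ 2
    exact (eLpNorm_weight_mul_le hΩ hh (hsm n) hM (hgrad n) hk.1 hχ hrep).trans
      (mul_le_mul_right (hηχ n) 3)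
  have hmeas : ∀ n, AEMeasurable (fun z => ‖η n z * k z‖ₑ ^ 2) μ := fun n =>
    ((((Complex.continuous_ofReal.comp (hsm n).continuous).aestronglyMeasurable.mul
      hk.1.2.1).enorm).pow_const 2)
  -- Half of δ^(-τ) lies strictly below the lower limit of the weights, as `hlow` requires; the
  -- factor 4 below undoes the halving.
  have hfatou : ∫⁻ z, (ENNReal.ofReal (d z ^ (-τ) / 2) * ‖k z‖ₑ) ^ 2 ∂μ ≤ B := by
    calc _ ≤ ∫⁻ z, Filter.liminf (fun n => ‖η n z * k z‖ₑ ^ 2) Filter.atTop ∂μ := by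
          refine setLIntegral_mono' hΩ.measurableSet fun z hz => ?_
          refine Filter.le_liminf_of_le (by isBoundedDefault) ?_
          have hp : 0 < d z ^ (-τ) := Real.rpow_pos_of_pos (hdpos z hz) _
          filter_upwards [hlow z hz (d z ^ (-τ) / 2) (half_lt_self hp)] with n h1
          rw [enorm_mul]
          gcongr
          rw [← ofReal_norm, Complex.norm_real, Real.norm_eq_abs]
          exact ENNReal.ofReal_le_ofReal h1
      _ ≤ Filter.liminf (fun n => ∫⁻ z, ‖η n z * k z‖ₑ ^ 2 ∂μ) Filter.atTop :=
          lintegral_liminf_le' hmeas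
      _ ≤ B := by
          refine Filter.liminf_le_of_le (by isBoundedDefault) fun b hb => ?_
          obtain ⟨n, hn'⟩ := hb.exists
          exact hn'.trans (hn n)
  have e : ∀ z, (ENNReal.ofReal (d z ^ (-τ)) * ‖k z‖ₑ) ^ 2 =
      4 * (ENNReal.ofReal (d z ^ (-τ) / 2) * ‖k z‖ₑ) ^ 2 := fun z => by
    have h1 : ENNReal.ofReal (d z ^ (-τ)) = 2 * ENNReal.ofReal (d z ^ (-τ) / 2) := by
      rw [← ENNReal.ofReal_ofNat 2, ← ENNReal.ofReal_mul (by norm_num)]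
      congr 1
      ring
    rw [h1]
    ring
  refine (lintegral_congr e).trans_lt ?_
  rw [lintegral_const_mul' _ _ (by norm_num)]
  exact ENNReal.mul_lt_top (by norm_num) (hfatou.trans_lt hBtop)

/-- The range r/2 < s < r alone contributes at least πr²/2, which exceeds r². -/
theorem ofReal_sq_le_discMass {r : ℝ} (hr : 0 < r) : ENNReal.ofReal (r ^ 2) ≤ discMass r := by
  have hpi := Real.pi_gt_three
  calc ENNReal.ofReal (r ^ 2)
      ≤ ENNReal.ofReal (r / 2 * (2 * Real.pi)) * ENNReal.ofReal (r / 2) := by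
        rw [← ENNReal.ofReal_mul (by positivity)]
        refine ENNReal.ofReal_le_ofReal ?_
        nlinarith [sq_nonneg r]
    _ = ∫⁻ _s in Set.Ioo (r / 2) r, ENNReal.ofReal (r / 2 * (2 * Real.pi)) := by
        rw [setLIntegral_const, Real.volume_Ioo]
        congr 2
        ring
    _ ≤ ∫⁻ s in Set.Ioo (r / 2) r, ENNReal.ofReal s * ENNReal.ofReal (2 * Real.pi) := by
        refine setLIntegral_mono' measurableSet_Ioo fun s hs => ?_
        have := hs.1
        rw [← ENNReal.ofReal_mul (by linarith)]
        exact ENNReal.ofReal_le_ofReal (by gcongr)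
    _ ≤ discMass r := lintegral_mono_set (Set.Ioo_subset_Ioo_left (by linarith))

/-- The disc misses the frontier, so a point of it outside Ω would lie in the exterior, and Ω and
the exterior would disconnect the disc. If the frontier is empty, `infDist` is 0 and the disc is
empty. -/
theorem ball_infDist_frontier_subset {Ω : Set ℂ} (hΩ : IsOpen Ω) {z : ℂ} (hz : z ∈ Ω) :
    ball z (infDist z (frontier Ω)) ⊆ Ω := by
  intro y hy
  by_contra hyΩ
  have hpos : 0 < infDist z (frontier Ω) := dist_nonneg.trans_lt (mem_ball.1 hy)
  have hdisj : ∀ x ∈ ball z (infDist z (frontier Ω)), x ∉ Ω → x ∉ closure Ω :=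
    fun x hx hxΩ hxc => by
      have h1 := infDist_le_dist_of_mem (x := z) (hΩ.frontier_eq ▸ ⟨hxc, hxΩ⟩ : x ∈ frontier Ω)
      rw [dist_comm] at h1
      exact absurd (mem_ball.1 hx) (not_lt.2 h1)
  obtain ⟨x, -, hxΩ, hxc⟩ := (convex_ball z (infDist z (frontier Ω))).isPreconnected Ω
    (closure Ω)ᶜ hΩ isClosed_closure.isOpen_compl
    (fun x hx => (em (x ∈ Ω)).imp id (hdisj x hx)) ⟨z, mem_ball_self hpos, hz⟩
    ⟨y, hy, hdisj y hy hyΩ⟩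
  exact hxc (subset_closure hxΩ)

/-- Pointwise decay from weighted square integrability. -/
theorem exists_norm_le_rpow {Ω : Set ℂ} (hΩ : IsOpen Ω) (hF : (frontier Ω).Nonempty) {τ : ℝ}
    (hτ : 0 ≤ τ) (hτ1 : τ ≤ 1) {k : ℂ → ℂ} (hk : DifferentiableOn ℂ k Ω)
    (hfin : ∫⁻ z in Ω, (ENNReal.ofReal (infDist z (frontier Ω) ^ (-τ)) * ‖k z‖ₑ) ^ 2 < ⊤) :
    ∃ C : ℝ, 0 ≤ C ∧ ∀ z ∈ Ω, ‖k z‖ ≤ C * infDist z (frontier Ω) ^ (τ - 1) := by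
  set A := ∫⁻ z in Ω, (ENNReal.ofReal (infDist z (frontier Ω) ^ (-τ)) * ‖k z‖ₑ) ^ 2 with hA
  -- 9 = (3/2)² · 2²: on the disc of radius d/2 the boundary distance is at most 3d/2, at a cost of
  -- at most 3/2 since τ ≤ 1, and the radius costs 2.
  refine ⟨Real.sqrt (A.toReal * 9), Real.sqrt_nonneg _, fun z hz => ?_⟩
  set d := infDist z (frontier Ω) with hd
  have hdpos : 0 < d := infDist_frontier_pos hΩ hF hz
  have hsub : ball z (d / 2) ⊆ Ω :=
    (ball_subset_ball (by linarith)).trans (ball_infDist_frontier_subset hΩ hz)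
  have h1 := enorm_mul_discMass_le (f := fun z => k z ^ 2) ((hk.mono hsub).pow 2)
  simp only [enorm_pow] at h1
  have h2 : ENNReal.ofReal ((3 / 2 * d) ^ (-τ)) ^ 2 * ∫⁻ ζ in ball z (d / 2), ‖k ζ‖ₑ ^ 2 ≤ A := by
    rw [← lintegral_const_mul' _ _ (ENNReal.pow_ne_top ENNReal.ofReal_ne_top)]
    refine le_trans ?_ (lintegral_mono_set hsub)
    refine setLIntegral_mono' measurableSet_ball fun ζ hζ => ?_
    rw [mul_pow]
    gcongr ENNReal.ofReal ?_ ^ 2 * _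
    have h3 : infDist ζ (frontier Ω) ≤ d + dist ζ z := infDist_le_infDist_add_dist
    have h4 := mem_ball.1 hζ
    exact Real.rpow_le_rpow_of_nonpos (infDist_frontier_pos hΩ hF (hsub hζ)) (by linarith)
      (by linarith)
  have h3 : ENNReal.ofReal ((3 / 2 * d) ^ (-τ)) ^ 2 *
      (‖k z‖ₑ ^ 2 * ENNReal.ofReal ((d / 2) ^ 2)) ≤ A := by
    refine le_trans ?_ h2
    gcongr
    exact (mul_le_mul_right (ofReal_sq_le_discMass (by positivity)) _).trans h1
  have h4 := ENNReal.toReal_mono hfin.ne h3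
  simp only [ENNReal.toReal_mul, ENNReal.toReal_pow, toReal_enorm] at h4
  have hp : 0 < (3 / 2 * d) ^ (-τ) := Real.rpow_pos_of_pos (by positivity) _
  rw [ENNReal.toReal_ofReal hp.le, ENNReal.toReal_ofReal (by positivity)] at h4
  have h5 : 2 / 3 * d ^ (-τ) ≤ (3 / 2 * d) ^ (-τ) := by
    rw [Real.mul_rpow (by norm_num) hdpos.le]
    gcongr
    calc (2 / 3 : ℝ) = (3 / 2) ^ (-1 : ℝ) := by rw [Real.rpow_neg_one]; norm_num
      _ ≤ (3 / 2) ^ (-τ) := Real.rpow_le_rpow_of_exponent_le (by norm_num) (by linarith)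
  have h6 : (2 / 3 * d ^ (-τ)) ^ 2 * (‖k z‖ ^ 2 * (d / 2) ^ 2) ≤ A.toReal :=
    le_trans (by gcongr) h4
  have hdτ : 0 < d ^ (-τ) := Real.rpow_pos_of_pos hdpos _
  have h7 : (‖k z‖ * (d ^ (-τ) * d)) ^ 2 ≤ A.toReal * 9 := by
    calc (‖k z‖ * (d ^ (-τ) * d)) ^ 2
        = 9 * ((2 / 3 * d ^ (-τ)) ^ 2 * (‖k z‖ ^ 2 * (d / 2) ^ 2)) := by ring
      _ ≤ _ := by linarith
  have h8 := Real.le_sqrt_of_sq_le h7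
  have e : d ^ (τ - 1) = (d ^ (-τ) * d)⁻¹ := by
    rw [← Real.rpow_add_one hdpos.ne', ← Real.rpow_neg hdpos.le]
    congr 1
    ring
  rw [e, ← div_eq_mul_inv, le_div_iff₀ (by positivity)]
  exact h8

/-- `K_Ω(·, w)` belongs to `L^p(Ω)` as soon as `3 (1 - 2 / p) ≤ h(Ω)`. -/
theorem IsReproducingAt.memLp {Ω : Set ℂ} (hΩ : IsOpen Ω) (hF : (frontier Ω).Nonempty) {p : ℝ}
    (hp : 2 ≤ p) (hh : ENNReal.ofReal (3 * (1 - 2 / p)) ≤ hardyConstant Ω) {w : ℂ} (hw : w ∈ Ω)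
    {k : ℂ → ℂ} (hk : IsReproducingAt Ω w k) :
    MemLp k (ENNReal.ofReal p) (volume.restrict Ω) := by
  have hp0 : 0 < p := by linarith
  have hτ : 0 ≤ 1 - 2 / p := sub_nonneg.2 ((div_le_one hp0).2 hp)
  have hτ1 : 1 - 2 / p ≤ 1 := by linarith [div_pos two_pos hp0]
  set τ := 1 - 2 / p with hτdef
  have hfin := lintegral_rpow_mul_enorm_sq_lt_top hΩ hF hτ hτ1 hh hw hk
  obtain ⟨C, hC, hle⟩ := exists_norm_le_rpow hΩ hF hτ hτ1 hk.1.1 hfin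
  refine ⟨hk.1.2.1, ?_⟩
  rw [eLpNorm_lt_top_iff_lintegral_rpow_enorm_lt_top (by simpa using hp0) ENNReal.ofReal_ne_top,
    ENNReal.toReal_ofReal hp0.le]
  -- The decay bound applied to |k|^(p-2) contributes δ^((τ-1)(p-2)) = δ^(-2τ), exactly the weight
  -- under which |k|² is integrable.
  refine lt_of_le_of_lt (b := ENNReal.ofReal (C ^ (p - 2)) *
    ∫⁻ z in Ω, (ENNReal.ofReal (infDist z (frontier Ω) ^ (-τ)) * ‖k z‖ₑ) ^ 2) ?_
    (ENNReal.mul_lt_top ENNReal.ofReal_lt_top hfin)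
  rw [← lintegral_const_mul' _ _ ENNReal.ofReal_ne_top]
  refine setLIntegral_mono' hΩ.measurableSet fun z hz => ?_
  have hd := infDist_frontier_pos hΩ hF hz
  have hz' := hle z hz
  set d := infDist z (frontier Ω) with hddef
  rw [← ofReal_norm, ENNReal.ofReal_rpow_of_nonneg (norm_nonneg _) hp0.le,
    ← ENNReal.ofReal_mul (by positivity), ← ENNReal.ofReal_pow (by positivity),
    ← ENNReal.ofReal_mul (by positivity)]
  refine ENNReal.ofReal_le_ofReal ?_
  have e1 : ‖k z‖ ^ p = ‖k z‖ ^ (p - 2) * ‖k z‖ ^ 2 := by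
    rcases (norm_nonneg (k z)).eq_or_lt with h | h
    · rw [← h, Real.zero_rpow hp0.ne']
      simp
    · rw [← Real.rpow_natCast ‖k z‖ 2, ← Real.rpow_add h]
      congr 1
      push_cast
      ring
  have e2 : (C * d ^ (τ - 1)) ^ (p - 2) = C ^ (p - 2) * (d ^ (-τ)) ^ 2 := by
    rw [Real.mul_rpow hC (by positivity), ← Real.rpow_natCast, ← Real.rpow_mul hd.le,
      ← Real.rpow_mul hd.le]
    congr 2
    rw [hτdef]
    push_cast
    field_simp
    ring
  calc ‖k z‖ ^ p = ‖k z‖ ^ (p - 2) * ‖k z‖ ^ 2 := e1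
    _ ≤ (C * d ^ (τ - 1)) ^ (p - 2) * ‖k z‖ ^ 2 := by
        gcongr
    _ = C ^ (p - 2) * (d ^ (-τ) * ‖k z‖) ^ 2 := by rw [e2]; ring

/-- Liouville's theorem for square integrable functions. -/
theorem MemBergman.eq_zero_of_univ {f : ℂ → ℂ} (hf : MemBergman Set.univ f) (w : ℂ) : f w = 0 := by
  by_contra hne
  have hA := hf.2.2
  set A := eLpNorm f 2 (volume.restrict Set.univ) ^ 2 with hAdef
  have hAtop : A ≠ ⊤ := ENNReal.pow_ne_top hA.ne
  have hpos : 0 < ‖f w‖ ^ 2 := by positivity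
  have hbound : ∀ r : ℝ, 0 < r → ‖f w‖ ^ 2 * r ^ 2 ≤ A.toReal := fun r hr => by
    have h1 := enorm_sq_mul_discMass_le (r := r) (w := w) hf.1 (Set.subset_univ _)
    have h2 := (mul_le_mul_right (ofReal_sq_le_discMass hr) (‖f w‖ₑ ^ 2)).trans h1
    have h3 := ENNReal.toReal_mono hAtop h2
    simp only [ENNReal.toReal_mul, ENNReal.toReal_pow, toReal_enorm] at h3
    rwa [ENNReal.toReal_ofReal (by positivity)] at h3
  have hA0 : 0 ≤ A.toReal := ENNReal.toReal_nonneg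
  -- The radius makes the left side equal to A + 1.
  have h := hbound (Real.sqrt ((A.toReal + 1) / ‖f w‖ ^ 2)) (by positivity)
  rw [Real.sq_sqrt (by positivity), mul_div_cancel₀ _ hpos.ne'] at h
  linarith

/-! ### From L^p membership to the integrability index -/

theorem le_integrabilityIndex {Ω : Set ℂ} {p : ℝ} (hp : 2 ≤ p)
    (h : ∀ w ∈ Ω, MemLp (fun z => bergmanKernel Ω z w) (ENNReal.ofReal p) (volume.restrict Ω)) :
    ENNReal.ofReal p ≤ integrabilityIndex Ω := by
  refine le_iSup₂_of_le (f := fun (p : ℝ≥0) _ => (p : ℝ≥0∞)) p.toNNReal ⟨?_, h⟩ le_rfl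
  rw [Real.le_toNNReal_iff_coe_le (by linarith)]
  exact_mod_cast hp

theorem eq_top_of_forall_two_le {x : ℝ≥0∞} (h : ∀ p : ℝ, 2 ≤ p → ENNReal.ofReal p ≤ x) :
    x = ⊤ := by
  refine ENNReal.eq_top_of_forall_nnreal_le fun r => ?_
  refine le_trans ?_ (h (r + 2) (by linarith [r.2]))
  rw [← ENNReal.ofReal_coe_nnreal]
  exact ENNReal.ofReal_le_ofReal (by linarith)

end

theorem theorem1p2 (Ω : Set ℂ) (hopen : IsOpen Ω) (hconn : IsConnected Ω) :
    6 / (3 - hardyConstant Ω) ≤ integrabilityIndex Ω := by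
  rcases (frontier Ω).eq_empty_or_nonempty with hF | hF
  -- Without boundary Ω is the plane, its Bergman space is zero, and the index is infinite.
  · have huniv : Ω = Set.univ := (isClopen_iff_frontier_eq_empty.2 hF).eq_univ hconn.nonempty
    subst huniv
    have hK : ∀ w, (fun z => bergmanKernel Set.univ z w) = 0 := fun w => by
      funext z
      exact (bergmanKernel_spec hopen (Set.mem_univ w)).1.eq_zero_of_univ z
    rw [eq_top_of_forall_two_le fun p hp => le_integrabilityIndex hp fun w _ => by
      rw [hK]
      exact MemLp.zero]
    exact le_top
  · have key : ∀ p : ℝ, 2 ≤ p → ENNReal.ofReal (3 * (1 - 2 / p)) ≤ hardyConstant Ω →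
        ENNReal.ofReal p ≤ integrabilityIndex Ω := fun p hp hh =>
      le_integrabilityIndex hp fun w hw =>
        (bergmanKernel_spec hopen hw).memLp hopen hF hp hh hw
    -- Subtraction is truncated: for h ≥ 3 the left side is 6/0 = ∞, and every p ≥ 2 is admissible
    -- because 3(1 - 2/p) < 3. This makes a proof of h ≤ 1 unnecessary.
    rcases le_or_gt 3 (hardyConstant Ω) with h3 | h3
    · rw [eq_top_of_forall_two_le fun p hp => key p hp (le_trans ?_ h3)]
      · exact le_top
      · rw [← ENNReal.ofReal_ofNat 3]
        refine ENNReal.ofReal_le_ofReal ?_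
        have : 0 < 2 / p := by positivity
        linarith
    · lift hardyConstant Ω to ℝ≥0 using h3.ne_top with h hh
      have h3' : (h : ℝ) < 3 := by exact_mod_cast h3
      have e : (6 : ℝ≥0∞) / (3 - h) = ENNReal.ofReal (6 / (3 - h)) := by
        rw [ENNReal.ofReal_div_of_pos (by linarith), ENNReal.ofReal_sub _ h.coe_nonneg,
          ENNReal.ofReal_coe_nnreal, ENNReal.ofReal_ofNat, ENNReal.ofReal_ofNat]
      rw [e]
      -- For p = 6/(3 - h) the number 3(1 - 2/p) is exactly h, so the endpoint exponent itself is
      -- reached.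
      refine key _ ?_ ?_
      · rw [le_div_iff₀ (by linarith)]
        linarith [h.2]
      · rw [← ENNReal.ofReal_coe_nnreal]
        refine ENNReal.ofReal_le_ofReal (le_of_eq ?_)
        have : (3 - h : ℝ) ≠ 0 := by linarith
        field_simp
        ring
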